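/- Work over $\mathbb{C}$. Let $n\ge 1$ and let $\underline a=(a_1,\dots,a_m)$, $\underline b=(b_1,\dots,b_t)$ be (possibly empty) sequences of positive integers with $\sum a_i\le n$ and $\sum b_j\le n$. Let $\mathfrak{sp}(2n)$ be the Lie algebra of all $X\in M_{2n}(\mathbb{C})$ with $X_{2n+1-j,\,2n+1-i}=-\varepsilon_i\varepsilon_jX_{i,j}$ for all $i,j$, where $\varepsilon_i=1$ for $i\le n$ and $\varepsilon_i=-1$ for $i>n$. Divide $1,\dots,2n$ into consecutive blocks of sizes $a_1,\dots,a_m,\,2(n-\sum a_i),\,a_m,\dots,a_1$ (the $a$-blocks) and likewise into $b$-blocks. The type-C seaweed $\mathfrak g=\mathfrak p_{2n}^C\frac{a_1|\dots|a_m}{b_1|\dots|b_t}$ is the Lie algebra of all $X\in\mathfrak{sp}(2n)$ whose entry $X_{i,j}$ vanishes unless $i\ge j$ and $i,j$ lie in one $a$-block, or $i\le j$ and $i,j$ lie in one $b$-block. The homotopy type of $\mathfrak g$ is found as follows. Start with the fraction $\frac{a_1|\dots|a_m}{b_1|\dots|b_t}$ on $n$ vertices. While numerator and denominator are both non-empty,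 with first parts $a_1$ and $b_1$, apply the one applicable move: * if $a_1>2b_1$, pass to $\frac{(a_1-2b_1)|b_1|a_2|\cdots}{b_2|\cdots}$; * if $a_1=2b_1$, pass to $\frac{b_1|a_2|\cdots}{b_2|\cdots}$; * if $b_1<a_1<2b_1$, pass to $\frac{b_1|a_2|\cdots}{(2b_1-a_1)|b_2|\cdots}$; * if $a_1=b_1$, pass to $\frac{a_2|\cdots}{b_2|\cdots}$ (deletion of a component of size $a_1$); * if $a_1<b_1$, exchange numerator and denominator. At each move other than the exchange, the number of vertices decreases by the decrease of the sum of the numerator (which equals that of the denominator). If the process ends with $k$ vertices, with $c_1|\dots|c_q$ on one side and with the other side empty, then the sizes of the deleted components, in order, are the first entries of the homotopy type, $c_1,\dots,c_q$ are its tail entries, and $2(k-\sum c_i)$ is its aftertail entry. Assume that no component is deleted, that all tail entries are $1$ (there may be none), and that the aftertail entry is $2$; that is, $\mathfrak g$ has homotopy type $\mathcal H_C(1,\dots,1,2)$ with tail entries $1,\dots,1$ and aftertail entry $2$. The oriented full meander of $\mathfrak g$ has vertices $v_1,\dots,v_{2n}$; its edges $(v_i,v_j)$ are those with $i>j$ where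 $i,j$ are mirror images of each other in an $a$-block, and those with $i<j$ where $i,j$ are mirror images of each other in a $b$-block (that is, $i+j$ is the sum of the first and the last element of the block). Let $e_{i,j}$ be the matrix units, let $e_{i,j}^*$ be the one-form $X\mapsto X_{i,j}$ on $\mathfrak g$, and let $$\varphi=e_{n,n}^*+\sum_{(v_i,v_j)}e_{i,j}^*\in\mathfrak g^*,$$ where the sum is over all edges $(v_i,v_j)$ of the oriented full meander with $i\le n-1$ or $j\le n-1$. Let $B_\varphi(x,y)=\varphi([x,y])$ be the Kirillov form of $\varphi$ on $\mathfrak g$. Then $e_{n,n}-e_{n+1,n+1}\in\mathfrak g$ and $$\ker(B_\varphi)=\{x\in\mathfrak g : B_\varphi(x,y)=0\text{ for all }y\in\mathfrak g\}=\operatorname{span}_{\mathbb C}\{e_{n,n}-e_{n+1,n+1}\}.$$ -/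

import Mathlib

attribute [local instance 100] LieRing.ofAssociativeRing

namespace TypeCSeaweed

/-- For a list `l` of block sizes, the `0`-based position `i` lies in the `k`-th block of `l`. -/
def InBlock (l : List ℕ) (k i : ℕ) : Prop :=
  (l.take k).sum ≤ i ∧ i < (l.take (k + 1)).sum

/-- The positions `i` and `j` lie in one and the same block of `l`. -/
def SameBlock (l : List ℕ) (i j : ℕ) : Prop :=
  ∃ k, InBlock l k i ∧ InBlock l k j

/-- The palindromic list `a₁ | … | aₘ | 2(n - ∑ aᵢ) | aₘ | … | a₁` of block sizes, which is a
composition of `2n` (up to a possible empty middle block) when `∑ aᵢ ≤ n`. -/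
def fullComposition (n : ℕ) (a : List ℕ) : List ℕ :=
  a ++ (2 * (n - a.sum)) :: a.reverse

/-- The location `(i, j)` is admissible: on or below the diagonal inside a block of the full
composition of `a`, or on or above the diagonal inside a block of the full composition of `b`. -/
def Admissible (n : ℕ) (a b : List ℕ) (i j : ℕ) : Prop :=
  (j ≤ i ∧ SameBlock (fullComposition n a) i j) ∨ (i ≤ j ∧ SameBlock (fullComposition n b) i j)

theorem SameBlock.symm {l : List ℕ} {i j : ℕ} (h : SameBlock l i j) : SameBlock l j i := by
  obtain ⟨k, h1, h2⟩ := h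
  exact ⟨k, h2, h1⟩

theorem take_sum_mono (l : List ℕ) {p q : ℕ} (h : p ≤ q) : (l.take p).sum ≤ (l.take q).sum :=
  (List.take_sublist_take_left h).sum_le_sum (by simp)

theorem InBlock.unique {l : List ℕ} {k m i : ℕ} (h : InBlock l k i) (h' : InBlock l m i) :
    k = m := by
  rcases lt_trichotomy k m with hlt | heq | hlt
  · have := take_sum_mono l (show k + 1 ≤ m from hlt)
    have h1 := h.2
    have h2 := h'.1
    omega
  · exact heq
  · have := take_sum_mono l (show m + 1 ≤ k from hlt)
    have h1 := h'.2
    have h2 := h.1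
    omega

theorem SameBlock.trans {l : List ℕ} {i j k : ℕ} (h : SameBlock l i j) (h' : SameBlock l j k) :
    SameBlock l i k := by
  obtain ⟨p, h1, h2⟩ := h
  obtain ⟨q, h3, h4⟩ := h'
  obtain rfl := h2.unique h3
  exact ⟨p, h1, h4⟩

theorem SameBlock.between {l : List ℕ} {i j k : ℕ} (h : SameBlock l i k) (hij : i ≤ j)
    (hjk : j ≤ k) : SameBlock l i j := by
  obtain ⟨p, h1, h2⟩ := h
  exact ⟨p, h1, le_trans h1.1 hij, lt_of_le_of_lt hjk h2.2⟩

theorem Admissible.trans {n : ℕ} {a b : List ℕ} {i j k : ℕ} (h : Admissible n a b i j)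
    (h' : Admissible n a b j k) : Admissible n a b i k := by
  rcases h with ⟨hij, h⟩ | ⟨hij, h⟩ <;> rcases h' with ⟨hjk, h'⟩ | ⟨hjk, h'⟩
  · exact Or.inl ⟨hjk.trans hij, h.trans h'⟩
  · rcases le_total k i with hki | hki
    · exact Or.inl ⟨hki, h.trans (h.symm.between hjk hki)⟩
    · exact Or.inr ⟨hki, (h'.between hij hki).symm.trans h'⟩
  · rcases le_total k i with hki | hki
    · exact Or.inl ⟨hki, (h'.symm.between hki hij).symm⟩
    · exact Or.inr ⟨hki, h.between hki hjk⟩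
  · exact Or.inr ⟨hij.trans hjk, h.trans h'⟩

/-- The matrices of size `2n` which vanish outside the admissible locations, that is, the sum of
the space of block-diagonal lower triangular matrices with blocks `fullComposition n a` and the
space of block-diagonal upper triangular matrices with blocks `fullComposition n b`. -/
def admissibleMatrices (n : ℕ) (a b : List ℕ) :
    LieSubalgebra ℂ (Matrix (Fin (2 * n)) (Fin (2 * n)) ℂ) where
  carrier := {X | ∀ i j : Fin (2 * n), ¬ Admissible n a b i j → X i j = 0}
  add_mem' {X Y} hX hY i j h := by simp [hX i j h, hY i j h]
  zero_mem' i j _ := rfl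
  smul_mem' c X hX i j h := by simp [hX i j h]
  lie_mem' {X Y} hX hY i j h := by
    have key : ∀ A B : Matrix (Fin (2 * n)) (Fin (2 * n)) ℂ,
        (∀ i j : Fin (2 * n), ¬ Admissible n a b i j → A i j = 0) →
        (∀ i j : Fin (2 * n), ¬ Admissible n a b i j → B i j = 0) → (A * B) i j = 0 := by
      intro A B hA hB
      rw [Matrix.mul_apply]
      refine Finset.sum_eq_zero fun k _ => ?_
      by_cases h1 : Admissible n a b i k
      · rw [hB k j fun h2 => h (h1.trans h2), mul_zero]
      · rw [hA i k h1, zero_mul]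
    rw [Ring.lie_def, Matrix.sub_apply, key X Y hX hY, key Y X hY hX, sub_zero]

/-- The antidiagonal matrix with entries `1` in its upper half and `-1` in its lower half. -/
def antidiagonalJ (n : ℕ) : Matrix (Fin (2 * n)) (Fin (2 * n)) ℂ :=
  Matrix.of fun i j => if (i : ℕ) + j + 1 = 2 * n then (if (i : ℕ) < n then 1 else -1) else 0

/-- The symplectic Lie algebra `𝔰𝔭(2n)` over `ℂ`, in the form that is symmetric about the
antidiagonal: spanned by `e_{i,j} - e_{2n-j+1,2n-i+1}` (`i, j ≤ n`), by
`e_{i,j} + e_{2n-j+1,2n-i+1}` (one of `i, j` at most `n`, the other one larger) and by the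
`e_{i,2n+1-i}`. -/
def sp (n : ℕ) : LieSubalgebra ℂ (Matrix (Fin (2 * n)) (Fin (2 * n)) ℂ) :=
  skewAdjointMatricesLieSubalgebra (antidiagonalJ n)

/-- The type-C seaweed `𝔭_{2n}^C (a₁|…|aₘ)/(b₁|…|bₜ)`. -/
def seaweed (n : ℕ) (a b : List ℕ) : LieSubalgebra ℂ (Matrix (Fin (2 * n)) (Fin (2 * n)) ℂ) :=
  sp n ⊓ admissibleMatrices n a b

/-- `HomotopyTypeC n a b D c r` says that winding down the meander on `n` vertices of fractional
form `a / b` performs the component deletions `C(d)` with `d` running through `D`, in this order,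
and ends at a meander of fractional form `c / ∅` (or `∅ / c`, its flip) on `k` vertices with
`r = 2 (k - ∑ c)`; thus the type-C homotopy type has the deleted components `D`, the tail
components `c` and the aftertail component `r`. -/
inductive HomotopyTypeC : ℕ → List ℕ → List ℕ → List ℕ → List ℕ → ℕ → Prop
  | doneBot (n : ℕ) (c : List ℕ) : HomotopyTypeC n c [] [] c (2 * (n - c.sum))
  | doneTop (n : ℕ) (c : List ℕ) : HomotopyTypeC n [] c [] c (2 * (n - c.sum))
  | pureContraction {n x y : ℕ} {a b D c : List ℕ} {r : ℕ} (h : 2 * y < x) :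
      HomotopyTypeC (n - y) ((x - 2 * y) :: y :: a) b D c r →
      HomotopyTypeC n (x :: a) (y :: b) D c r
  | blockElimination {n x y : ℕ} {a b D c : List ℕ} {r : ℕ} (h : x = 2 * y) :
      HomotopyTypeC (n - y) (y :: a) b D c r →
      HomotopyTypeC n (x :: a) (y :: b) D c r
  | rotationContraction {n x y : ℕ} {a b D c : List ℕ} {r : ℕ} (h : y < x) (h' : x < 2 * y) :
      HomotopyTypeC (n - (x - y)) (y :: a) ((2 * y - x) :: b) D c r →
      HomotopyTypeC n (x :: a) (y :: b) D c r
  | componentDeletion {n x : ℕ} {a b D c : List ℕ} {r : ℕ} :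
      HomotopyTypeC (n - x) a b D c r →
      HomotopyTypeC n (x :: a) (x :: b) (x :: D) c r
  | flip {n x y : ℕ} {a b D c : List ℕ} {r : ℕ} (h : x < y) :
      HomotopyTypeC n (y :: b) (x :: a) D c r →
      HomotopyTypeC n (x :: a) (y :: b) D c r

/-- `i` and `j` are the distinct endpoints of an arc of the meander with blocks `l`: they are
mirror images of each other in some block of `l`. -/
def IsArc (l : List ℕ) (i j : ℕ) : Prop :=
  i ≠ j ∧ ∃ k, InBlock l k i ∧ InBlock l k j ∧ i + j + 1 = (l.take k).sum + (l.take (k + 1)).sum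

/-- `(v_i, v_j)` (with `0`-based labels) is an edge of the full meander on `2n` vertices with its
counterclockwise orientation: top arcs, given by `a`, run from right to left, and bottom arcs,
given by `b`, from left to right. -/
def OrientedFullMeanderEdge (n : ℕ) (a b : List ℕ) (i j : ℕ) : Prop :=
  (j < i ∧ IsArc (fullComposition n a) i j) ∨ (i < j ∧ IsArc (fullComposition n b) i j)

open Classical in
/-- The edges `(v_i, v_j)` of the oriented full meander for which one of the `1`-based labels
`i + 1`, `j + 1` is at most `n - 1`. -/
noncomputable def formEdges (n : ℕ) (a b : List ℕ) : Finset (Fin (2 * n) × Fin (2 * n)) :=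
  Finset.univ.filter fun p =>
    OrientedFullMeanderEdge n a b p.1 p.2 ∧ ((p.1 : ℕ) + 1 ≤ n - 1 ∨ (p.2 : ℕ) + 1 ≤ n - 1)

/-- The one-form `e_{i,j}^*` on a Lie algebra of matrices: it returns the `(i, j)` entry. -/
def entryForm {m : ℕ} (g : LieSubalgebra ℂ (Matrix (Fin m) (Fin m) ℂ)) (i j : Fin m) :
    Module.Dual ℂ g :=
  Matrix.entryLinearMap ℂ ℂ i j ∘ₗ g.toSubmodule.subtype

/-- The (`1`-based) index `n` among `1, …, 2n`. -/
def idxN {n : ℕ} (hn : 0 < n) : Fin (2 * n) := ⟨n - 1, by omega⟩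

/-- The (`1`-based) index `n + 1` among `1, …, 2n`. -/
def idxNSucc {n : ℕ} (hn : 0 < n) : Fin (2 * n) := ⟨n, by omega⟩

/-- The one-form `e_{n,n}^* + ∑ e_{i,j}^*`, the sum being over the edges `(v_i, v_j)` of the
oriented full meander with `i ≤ n - 1` or `j ≤ n - 1`. -/
noncomputable def aftertailForm {n : ℕ} (hn : 0 < n) (a b : List ℕ) :
    Module.Dual ℂ (seaweed n a b) :=
  entryForm _ (idxN hn) (idxN hn) + ∑ p ∈ formEdges n a b, entryForm _ p.1 p.2

/-- The Kirillov form `B_φ(x, y) = φ [x, y]`. -/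
def kirillovForm {L : Type*} [LieRing L] [LieAlgebra ℂ L] (φ : Module.Dual ℂ L) :
    LinearMap.BilinForm ℂ L :=
  LinearMap.mk₂ ℂ (fun x y => φ ⁅x, y⁆) (by simp) (by simp) (by simp) (by simp)

end TypeCSeaweed

/-! Pair matrices by the trace and represent φ by a matrix f, so that φ([x,y]) = tr([f,x]y); being
in the kernel means that [f,x] is orthogonal to the seaweed. With no deletion, tail 1|⋯|1 of length
q and aftertail 2, `HomotopyTypeC.sums` fixes the shape: one composition has sum N = n-1, the other
t = N-q. Transposition exchanges the two sides, so let a have sum N.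

With 0-based positions, no arc of φ meets N or N+1, so the middle coroot lies in the kernel.
Conversely, let x be in the kernel. Positions N, N+1 carry a copy of sl₂ on which e_{n,n}^* is
stabilised only by the Cartan line. The rows [t,N) carry a corner above the diagonal, through the
middle b-block. Testing against this corner makes the upper left part of x skew on [t,N)², while the
corner of x itself enters the equations of the upper left part as a symmetric unknown S. What
remains is a problem of type A on [0,N): a pair (x,S), with x skew and S symmetric on [t,N)², must
vanish. This is `Rigid`.

`Rigid` is proved by induction along the winding-down. The arcs of the first blocks identify parts
of x with one another, so that x is determined by a matrix in the seaweed of the next meander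
satisfying the same equations there (`Rigid.contraction`, `Rigid.rotation`, `Rigid.flip`). All moves
happen to the left of t and leave [t,N) untouched. At the end (`rigid_replicate_one`) x is upper
triangular and skew, hence zero, and then S = 0. `eq_zero_of_fullBracket` returns from `Rigid` to
the symplectic kernel. -/

namespace TypeCSeaweed

/-! ### The reduced problem of type A -/

/-- Prepend the block `[s, e)` to a same-block relation. -/
def consBlock (s e : ℕ) (R : ℕ → ℕ → Prop) (i j : ℕ) : Prop :=
  (s ≤ i ∧ i < e ∧ s ≤ j ∧ j < e) ∨ R i j

/-- Prepend the reversal of the block `[s, e)` to a map. -/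
def consMirror (s e : ℕ) (σ : ℕ → ℕ) (i : ℕ) : ℕ :=
  if s ≤ i ∧ i < e then s + e - 1 - i else σ i

/-- Lower entries allowed by `R`, upper entries allowed by `Q`. -/
def Allowed (R Q : ℕ → ℕ → Prop) (i j : ℕ) : Prop :=
  (j ≤ i ∧ R i j) ∨ (i ≤ j ∧ Q i j)

/-- The `(j, i)` entry of the commutator `[f, x]`, where `f` represents the form given by the
arcs of the mirror maps `σ` (top) and `τ` (bottom). -/
noncomputable def arcBracket (σ τ : ℕ → ℕ) (x : ℕ → ℕ → ℂ) (j i : ℕ) : ℂ :=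
  (if j < σ j then x (σ j) i else 0) + (if τ j < j then x (τ j) i else 0)
    - (if σ i < i then x j (σ i) else 0) - (if i < τ i then x j (τ i) else 0)

/-- The pairs `(x, S)` of an allowed matrix, skew on `[t, N)`, and a symmetric matrix on `[t, N)`,
for which the form represented by `arcBracket x` agrees with `S`, are trivial. -/
def Rigid (R Q : ℕ → ℕ → Prop) (σ τ : ℕ → ℕ) (t N : ℕ) : Prop :=
  ∀ x S : ℕ → ℕ → ℂ,
    (∀ i j, ¬ Allowed R Q i j → x i j = 0) →
    (∀ i j, t ≤ i → i < N → t ≤ j → j < N → x i j = - x j i) →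
    (∀ i j, t ≤ i → i < N → t ≤ j → j < N → S i j = S j i) →
    (∀ i j, Allowed R Q i j →
      arcBracket σ τ x j i = if t ≤ i ∧ i < N ∧ t ≤ j ∧ j < N then S j i else 0) →
    (∀ i j, x i j = 0) ∧ ∀ i j, t ≤ i → i < N → t ≤ j → j < N → S i j = 0

/-- Transposing x and f exchanges the two sides, and [fᵀ,xᵀ] = -[f,x]ᵀ; hence S is replaced by -S.
Skewness and symmetry survive. -/
theorem Rigid.flip {R Q : ℕ → ℕ → Prop} {σ τ : ℕ → ℕ} {t N : ℕ} (hR : ∀ i j, R i j → R j i)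
    (hQ : ∀ i j, Q i j → Q j i) (h : Rigid R Q σ τ t N) : Rigid Q R τ σ t N := by
  intro x S hx hT hS hE
  have hA : ∀ i j, Allowed R Q i j → Allowed Q R j i := by
    rintro i j (⟨h1, h2⟩ | ⟨h1, h2⟩)
    · exact Or.inr ⟨h1, hR _ _ h2⟩
    · exact Or.inl ⟨h1, hQ _ _ h2⟩
  have hA' : ∀ i j, Allowed Q R j i → Allowed R Q i j := by
    rintro i j (⟨h1, h2⟩ | ⟨h1, h2⟩)
    · exact Or.inr ⟨h1, hQ _ _ h2⟩
    · exact Or.inl ⟨h1, hR _ _ h2⟩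
  obtain ⟨h1, h2⟩ := h (fun i j => x j i) (fun i j => - S i j)
    (fun i j hij => hx j i fun h => hij (hA' i j h))
    (fun i j a b c d => hT j i c d a b)
    (fun i j a b c d => by simp only [hS i j a b c d])
    (fun i j hij => by
      have := hE j i (hA i j hij)
      unfold arcBracket at this ⊢
      by_cases hc : t ≤ i ∧ i < N ∧ t ≤ j ∧ j < N
      · have hc' : t ≤ j ∧ j < N ∧ t ≤ i ∧ i < N := ⟨hc.2.2.1, hc.2.2.2, hc.1, hc.2.1⟩
        rw [if_pos hc'] at this
        rw [if_pos hc, hS j i hc'.1 hc'.2.1 hc.1 hc.2.1, ← this]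
        ring
      · have hc' : ¬ (t ≤ j ∧ j < N ∧ t ≤ i ∧ i < N) := fun h => hc ⟨h.2.2.1, h.2.2.2, h.1, h.2.1⟩
        rw [if_neg hc'] at this
        rw [if_neg hc]
        linear_combination -this)
  exact ⟨fun i j => h1 j i, fun i j a b c d => by simpa using h2 i j a b c d⟩

theorem consMirror_of_mem {s e i p : ℕ} (σ : ℕ → ℕ) (h1 : s ≤ i) (h2 : i < e)
    (h : i + p + 1 = s + e) : consMirror s e σ i = p := by
  rw [consMirror, if_pos ⟨h1, h2⟩]
  omega

theorem consMirror_of_le {s e i : ℕ} (σ : ℕ → ℕ) (h : e ≤ i) : consMirror s e σ i = σ i := by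
  rw [consMirror, if_neg (by omega)]

/-! ### Rigidity under the contraction moves -/

/-- Pure contraction and block elimination. -/
theorem Rigid.contraction {R Q : ℕ → ℕ → Prop} {σ τ : ℕ → ℕ} {t N s m k e : ℕ}
    (hsm : s ≤ m) (hmk : m ≤ k) (hke : k ≤ e) (hlen : s + e = m + k) (hmt : m ≤ t)
    (hR : ∀ i j, R i j → e ≤ i ∧ e ≤ j) (hQ : ∀ i j, Q i j → m ≤ i ∧ m ≤ j)
    (hσ : ∀ i, e ≤ i → e ≤ σ i) (hτ : ∀ i, m ≤ i → m ≤ τ i)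
    (h : Rigid (consBlock m k (consBlock k e R)) Q (consMirror m k (consMirror k e σ)) τ t N) :
    Rigid (consBlock s e R) (consBlock s m Q) (consMirror s e σ) (consMirror s m τ) t N := by
  intro x S hx hT hS hE
  have row0 : ∀ i j, i < m → m ≤ j → x i j = 0 := by
    intro i j h1 h2
    apply hx
    grind [Allowed, consBlock]
  have low0 : ∀ i j, e ≤ i → j < e → x i j = 0 := by
    intro i j h1 h2
    apply hx
    grind [Allowed, consBlock]
  have neg0 : ∀ i j, (i < s ∨ j < s) → x i j = 0 := by
    intro i j h1
    apply hx
    grind [Allowed, consBlock]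
  have hlow : ∀ i j, j ≤ i → s ≤ j → i < e →
      Allowed (consBlock s e R) (consBlock s m Q) i j :=
    fun i j h1 h2 h3 => Or.inl ⟨h1, Or.inl ⟨by omega, h3, h2, by omega⟩⟩
  have hup : ∀ i j, s ≤ i → i < m → s ≤ j → j < m →
      Allowed (consBlock s e R) (consBlock s m Q) i j := by
    intro i j h1 h2 h3 h4
    rcases le_total j i with h | h
    · exact Or.inl ⟨h, Or.inl ⟨by omega, by omega, by omega, by omega⟩⟩
    · exact Or.inr ⟨h, Or.inl ⟨by omega, by omega, by omega, by omega⟩⟩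
  -- the action on the ideal with columns in `[s, m)` and rows in `[m, e)`
  have hK : ∀ j i q p, k ≤ j → j < e → m ≤ i → i < e → j + q + 1 = s + e → i + p + 1 = s + e →
      x j i = if k ≤ i then x q p else 0 := by
    intro j i q p h1 h2 h3 h4 hq hp
    have := hE i q (hlow _ _ (by omega) (by omega) h4)
    rw [arcBracket, consMirror_of_mem σ (by omega) (by omega) (show q + j + 1 = s + e by omega),
      consMirror_of_mem σ (by omega) (by omega) hp, consMirror_of_le τ h3,
      consMirror_of_mem τ (by omega) (by omega)
        (show q + (s + m - 1 - q) + 1 = s + m by omega), if_neg (by omega : ¬ (_ ∧ _)),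
      if_pos (by omega : q < j), row0 (s + m - 1 - q) i (by omega) h3, row0 q (τ i) (by omega) (hτ i h3)] at this
    simp only [ite_self, add_zero, sub_zero] at this
    rw [sub_eq_zero] at this
    rw [this]
    by_cases hki : k ≤ i
    · rw [if_pos hki, if_pos (by omega)]
    · rw [if_neg hki, row0 q p (by omega) (by omega), ite_self]
  -- the action on `gl [s, m)`
  have hI : ∀ j i q p p' q', k ≤ j → j < e → k ≤ i → i < e →
      j + q + 1 = s + e → i + p + 1 = s + e → i + p' + 1 = k + e → j + q' + 1 = k + e →
      x j p = (if p' < i then x j p' else 0) - (if j < q' then x q' i else 0) := by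
    intro j i q p p' q' h1 h2 h3 h4 hq hp hp' hq'
    have := hE p q (hup _ _ (by omega) (by omega) (by omega) (by omega))
    rw [arcBracket, consMirror_of_mem σ (by omega) (by omega) (show q + j + 1 = s + e by omega),
      consMirror_of_mem σ (by omega) (by omega) (show p + i + 1 = s + e by omega),
      consMirror_of_mem τ (by omega) (by omega)
        (show q + (s + m - 1 - q) + 1 = s + m by omega),
      consMirror_of_mem τ (by omega) (by omega)
        (show p + (s + m - 1 - p) + 1 = s + m by omega),
      if_neg (by omega : ¬ (_ ∧ _)), if_pos (by omega : q < j), if_neg (by omega : ¬ i < p)] at this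
    have e1 := hK j p' q (s + m - 1 - p) h1 h2 (by omega) (by omega) hq (by omega)
    have e2 := hK q' i (s + m - 1 - q) p (by omega) (by omega) (by omega) (by omega)
      (by omega) (by omega)
    rw [if_pos (by omega)] at e1 e2
    rw [e1, e2]
    have c1 : p' < i ↔ p < s + m - 1 - p := by omega
    have c2 : j < q' ↔ s + m - 1 - q < q := by omega
    simp only [c1, c2]
    linear_combination this
  -- The part of x with indices ≥ m solves the smaller problem. By `hK` its rows in [k,e) vanish on
  -- the columns [m,k), so the top block splits at k. By `hI` the arcs joining [s,m) to [k,e) act as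
  -- the reversal of [k,e): the bottom arcs of [s,m) are carried along them and become top arcs.
  obtain ⟨h1, h2⟩ := h (fun i j => if m ≤ i ∧ m ≤ j then x i j else 0) S
    (by
      intro i j hij
      by_cases hc : m ≤ i ∧ m ≤ j
      · simp only [if_pos hc]
        by_cases hc' : k ≤ i ∧ i < e ∧ j < k
        · rw [hK i j _ _ hc'.1 hc'.2.1 hc.2 (by omega) (show i + (s + e - 1 - i) + 1 = s + e by omega)
            (show j + (s + e - 1 - j) + 1 = s + e by omega), if_neg (by omega)]
        · apply hx
          intro hal
          apply hij
          rcases hal with ⟨h1, h2⟩ | ⟨h1, h2⟩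
          · refine Or.inl ⟨h1, ?_⟩
            rcases h2 with h2 | h2
            · by_cases hk : k ≤ i
              · exact Or.inr (Or.inl ⟨by omega, by omega, by omega, by omega⟩)
              · exact Or.inl ⟨by omega, by omega, by omega, by omega⟩
            · exact Or.inr (Or.inr h2)
          · refine Or.inr ⟨h1, ?_⟩
            rcases h2 with h2 | h2
            · omega
            · exact h2
      · rw [if_neg hc])
    (by
      intro i j a b c d
      rw [if_pos ⟨by omega, by omega⟩, if_pos ⟨by omega, by omega⟩, hT i j a b c d]) hS
    (by
      intro i j hij
      have hmi : m ≤ i ∧ m ≤ j := by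
        rcases hij with ⟨h1, h2 | h2 | h2⟩ | ⟨h1, h2⟩
        · omega
        · omega
        · have := hR _ _ h2
          omega
        · exact hQ _ _ h2
      obtain ⟨hmi, hmj⟩ := hmi
      have hold : Allowed (consBlock s e R) (consBlock s m Q) i j := by
        rcases hij with ⟨h1, h2 | h2 | h2⟩ | ⟨h1, h2⟩
        · exact hlow _ _ h1 (by omega) (by omega)
        · exact hlow _ _ h1 (by omega) (by omega)
        · exact Or.inl ⟨h1, Or.inr h2⟩
        · exact Or.inr ⟨h1, Or.inr h2⟩
      rw [← hE i j hold]
      have hA : (if j < consMirror m k (consMirror k e σ) j then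
            x (consMirror m k (consMirror k e σ) j) i else 0) =
          (if j < consMirror s e σ j then x (consMirror s e σ j) i else 0) +
            if k ≤ j ∧ j < e ∧ j < k + e - 1 - j then x (k + e - 1 - j) i else 0 := by
        by_cases hjk : j < k
        · rw [consMirror_of_mem (p := s + e - 1 - j) _ (by omega) (by omega) (by omega),
            consMirror_of_mem (p := s + e - 1 - j) _ (by omega) (by omega) (by omega),
            if_neg (by omega : ¬ (k ≤ j ∧ _)), add_zero]
        rw [consMirror_of_le _ (by omega : k ≤ j)]
        by_cases hje : j < e
        · rw [consMirror_of_mem (s := s) (p := s + e - 1 - j) _ (by omega) (by omega) (by omega),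
            consMirror_of_mem (p := k + e - 1 - j) _ (by omega) (by omega) (by omega),
            if_neg (by omega : ¬ j < s + e - 1 - j), zero_add]
          simp only [not_lt.1 hjk, hje, true_and]
        · rw [consMirror_of_le _ (by omega : e ≤ j), consMirror_of_le _ (by omega : e ≤ j),
            if_neg (by omega : ¬ (k ≤ j ∧ _)), add_zero]
      have hB : (if consMirror m k (consMirror k e σ) i < i then
            x j (consMirror m k (consMirror k e σ) i) else 0) =
          (if consMirror s e σ i < i then x j (consMirror s e σ i) else 0) +
            if k ≤ i ∧ i < e then
              (if k + e - 1 - i < i then x j (k + e - 1 - i) else 0) - x j (s + e - 1 - i)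
            else 0 := by
        by_cases hjk : i < k
        · rw [consMirror_of_mem (p := s + e - 1 - i) _ (by omega) (by omega) (by omega),
            consMirror_of_mem (p := s + e - 1 - i) _ (by omega) (by omega) (by omega),
            if_neg (by omega : ¬ (k ≤ i ∧ _)), add_zero]
        rw [consMirror_of_le _ (by omega : k ≤ i)]
        by_cases hje : i < e
        · rw [consMirror_of_mem (s := s) (p := s + e - 1 - i) _ (by omega) (by omega) (by omega),
            consMirror_of_mem (p := k + e - 1 - i) _ (by omega) (by omega) (by omega),
            if_pos (by omega : s + e - 1 - i < i), if_pos (⟨by omega, hje⟩ : k ≤ i ∧ i < e)]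
          ring
        · rw [consMirror_of_le _ (by omega : e ≤ i), consMirror_of_le _ (by omega : e ≤ i),
            if_neg (by omega : ¬ (k ≤ i ∧ _)), add_zero]
      -- The corrections to the two sides of the commutator cancel: this is `hI` on [k,e)², and
      -- outside it every term is zero.
      have hAB : (if k ≤ j ∧ j < e ∧ j < k + e - 1 - j then x (k + e - 1 - j) i else 0) =
          if k ≤ i ∧ i < e then
              (if k + e - 1 - i < i then x j (k + e - 1 - i) else 0) - x j (s + e - 1 - i)
            else 0 := by
        by_cases hi : k ≤ i ∧ i < e
        · rw [if_pos hi]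
          by_cases hj : k ≤ j ∧ j < e
          · rw [hI j i (s + e - 1 - j) (s + e - 1 - i) (k + e - 1 - i) (k + e - 1 - j) hj.1 hj.2
              hi.1 hi.2 (by omega) (by omega) (by omega) (by omega)]
            simp only [hj, true_and]
            ring
          · have hej : e ≤ j := by
              rcases hij with ⟨h1, h2 | h2 | h2⟩ | ⟨h1, h2⟩
              · omega
              · omega
              · have := hR _ _ h2
                omega
              · omega
            rw [if_neg (by omega), low0 j _ hej (by omega), low0 j _ hej (by omega)]
            simp
        · rw [if_neg hi]
          split_ifs with hj
          · have hik : i < k := by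
              rcases hij with ⟨h1, h2 | h2 | h2⟩ | ⟨h1, h2⟩
              · omega
              · omega
              · have := hR _ _ h2
                omega
              · omega
            rw [hK _ i _ _ (by omega) (by omega) hmi (by omega)
              (show k + e - 1 - j + (s + e - 1 - (k + e - 1 - j)) + 1 = s + e by omega)
              (show i + (s + e - 1 - i) + 1 = s + e by omega), if_neg (by omega)]
          · rfl
      have ge : ∀ i, m ≤ i → m ≤ consMirror m k (consMirror k e σ) i := by
        intro i hi
        have := hσ i
        unfold consMirror
        split_ifs <;> omega
      unfold arcBracket
      rw [consMirror_of_le τ hmi, consMirror_of_le τ hmj]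
      simp only [hmi, hmj, hτ i hmi, hτ j hmj, ge i hmi, ge j hmj, and_self, if_true]
      linear_combination hA - hB + hAB)
  have h1' : ∀ i j, m ≤ i → m ≤ j → x i j = 0 := fun i j a b => by simpa [a, b] using h1 i j
  refine ⟨?_, h2⟩
  -- The square [s,m)² is the reversed copy of [k,e)², by `hK`.
  have hII : ∀ i j, i < m → x i j = 0 := by
    intro i j hi
    by_cases hj : m ≤ j
    · exact row0 i j hi hj
    by_cases hs : i < s ∨ j < s
    · exact neg0 i j hs
    have := hK (s + e - 1 - i) (s + e - 1 - j) i j (by omega) (by omega) (by omega) (by omega)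
      (by omega) (by omega)
    rw [if_pos (by omega), h1' _ _ (by omega) (by omega)] at this
    exact this.symm
  intro i j
  by_cases hi : i < m
  · exact hII i j hi
  by_cases hj : m ≤ j
  · exact h1' i j (by omega) hj
  by_cases hs : j < s
  · exact neg0 i j (Or.inr hs)
  by_cases hie : e ≤ i
  · exact low0 i j hie (by omega)
  by_cases hik : k ≤ i
  · rw [hI i (s + e - 1 - j) (s + e - 1 - i) j _ _ hik (by omega) (by omega) (by omega)
      (by omega) (by omega) (show s + e - 1 - j + (k + e - 1 - (s + e - 1 - j)) + 1 = k + e by omega)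
      (show i + (k + e - 1 - i) + 1 = k + e by omega), h1' _ _ (by omega) (by omega),
      h1' _ _ (by omega) (by omega)]
    simp
  -- The last rectangle has rows in [m,k) and columns in [s,m). Testing against the unit at
  -- (s+e-1-j, i) isolates x i j, since all other entries involved have both indices ≥ m and S is
  -- already zero.
  · have := hE (s + e - 1 - j) i (hlow _ _ (by omega) (by omega) (by omega))
    have hi' : m ≤ consMirror s e σ i := by
      rw [consMirror_of_mem (p := s + e - 1 - i) _ (by omega) (by omega) (by omega)]
      omega
    rw [arcBracket, consMirror_of_le τ (by omega : m ≤ i),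
      consMirror_of_le τ (by omega : m ≤ s + e - 1 - j),
      consMirror_of_mem (i := s + e - 1 - j) (p := j) σ (by omega) (by omega) (by omega),
      h1' _ _ hi' (by omega), h1' _ _ (hτ i (by omega)) (by omega),
      h1' _ _ (by omega) (hτ _ (by omega)), if_pos (by omega : j < s + e - 1 - j)] at this
    simp only [ite_self, add_zero, sub_zero, zero_sub] at this
    split_ifs at this with hc
    · rw [h2 _ _ hc.2.2.1 hc.2.2.2 hc.1 hc.2.1] at this
      simpa using this
    · simpa using this

/-- Rotation contraction. -/
theorem Rigid.rotation {R Q : ℕ → ℕ → Prop} {σ τ : ℕ → ℕ} {t N s d m e : ℕ}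
    (hsd : s ≤ d) (hdm : d ≤ m) (hme : m ≤ e) (hlen : s + e = d + m) (hmt : m ≤ t)
    (hR : ∀ i j, R i j → e ≤ i ∧ e ≤ j) (hQ : ∀ i j, Q i j → m ≤ i ∧ m ≤ j)
    (hσ : ∀ i, e ≤ i → e ≤ σ i) (hτ : ∀ i, m ≤ i → m ≤ τ i)
    (h : Rigid (consBlock d e R) (consBlock d m Q) (consMirror d e σ) (consMirror d m τ) t N) :
    Rigid (consBlock s e R) (consBlock s m Q) (consMirror s e σ) (consMirror s m τ) t N := by
  intro x S hx hT hS hE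
  have row0 : ∀ i j, i < m → m ≤ j → x i j = 0 := by
    intro i j h1 h2
    apply hx
    grind [Allowed, consBlock]
  have low0 : ∀ i j, e ≤ i → j < e → x i j = 0 := by
    intro i j h1 h2
    apply hx
    grind [Allowed, consBlock]
  have neg0 : ∀ i j, (i < s ∨ j < s) → x i j = 0 := by
    intro i j h1
    apply hx
    grind [Allowed, consBlock]
  have hlow : ∀ i j, j ≤ i → s ≤ j → i < e →
      Allowed (consBlock s e R) (consBlock s m Q) i j :=
    fun i j h1 h2 h3 => Or.inl ⟨h1, Or.inl ⟨by omega, h3, h2, by omega⟩⟩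
  have hup : ∀ i j, s ≤ i → i < m → s ≤ j → j < m →
      Allowed (consBlock s e R) (consBlock s m Q) i j := by
    intro i j h1 h2 h3 h4
    rcases le_total j i with h | h
    · exact Or.inl ⟨h, Or.inl ⟨by omega, by omega, by omega, by omega⟩⟩
    · exact Or.inr ⟨h, Or.inl ⟨by omega, by omega, by omega, by omega⟩⟩
  -- the action on the ideal with columns in `[s, m)` and rows in `[m, e)`
  have hV : ∀ j i q p, d ≤ j → j < e → m ≤ i → i < e → j + q + 1 = s + e → i + p + 1 = s + e →
      x q p = if q < j then x j i else 0 := by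
    intro j i q p h1 h2 h3 h4 hq hp
    have := hE i q (hlow _ _ (by omega) (by omega) h4)
    rw [arcBracket, consMirror_of_mem σ (by omega) (by omega) (show q + j + 1 = s + e by omega),
      consMirror_of_mem σ (by omega) (by omega) hp, consMirror_of_le τ h3,
      consMirror_of_mem τ (by omega) (by omega)
        (show q + (s + m - 1 - q) + 1 = s + m by omega), if_neg (by omega : ¬ (_ ∧ _)),
      if_pos (by omega : p < i), row0 (s + m - 1 - q) i (by omega) h3,
      row0 q (τ i) (by omega) (hτ i h3)] at this
    simp only [ite_self, add_zero, sub_zero] at this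
    exact (sub_eq_zero.1 this).symm
  -- The mirror of this rectangle is rows [d,m), columns [m,e), which no block allows. Its vanishing
  -- is what puts the matrix `y` below into the smaller seaweed.
  have hZ : ∀ q p, d ≤ q → q < m → p < d → x q p = 0 := by
    intro q p h1 h2 h3
    by_cases hs : p < s
    · exact neg0 q p (Or.inr hs)
    · rw [hV (s + e - 1 - q) (s + e - 1 - p) q p (by omega) (by omega) (by omega) (by omega)
        (by omega) (by omega), row0 (s + e - 1 - q) _ (by omega) (by omega), ite_self]
  -- The equations from gl on [s,m), rewritten through the reversal of [s,e), which maps [s,m) to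
  -- [d,e). The bottom arcs of [s,m) become top arcs of [d,e), and the top arcs inside [d,m) become
  -- bottom arcs of [d,m).
  have hI : ∀ j i q p, d ≤ j → j < e → d ≤ i → i < e → j + q + 1 = s + e → i + p + 1 = s + e →
      (if q < j then x j p else 0) +
        (if j < d + e - 1 - j then x (s + e - 1 - (d + e - 1 - j)) p else 0)
        - (if i < p then x q i else 0)
        - (if d + e - 1 - i < i then x q (s + e - 1 - (d + e - 1 - i)) else 0) = 0 := by
    intro j i q p h1 h2 h3 h4 hq hp
    have := hE p q (hup _ _ (by omega) (by omega) (by omega) (by omega))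
    rw [arcBracket, consMirror_of_mem σ (by omega) (by omega) (show q + j + 1 = s + e by omega),
      consMirror_of_mem σ (by omega) (by omega) (show p + i + 1 = s + e by omega),
      consMirror_of_mem (p := s + e - 1 - (d + e - 1 - j)) τ (by omega) (by omega) (by omega),
      consMirror_of_mem (p := s + e - 1 - (d + e - 1 - i)) τ (by omega) (by omega) (by omega),
      if_neg (by omega : ¬ (_ ∧ _))] at this
    have c1 : s + e - 1 - (d + e - 1 - j) < q ↔ j < d + e - 1 - j := by omega
    have c2 : p < s + e - 1 - (d + e - 1 - i) ↔ d + e - 1 - i < i := by omega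
    simp only [c1, c2] at this
    exact this
  -- The new matrix glues the reversed copy of x on [s,m)² to x itself on the indices ≥ m. The two
  -- agree on the overlap [m,e)² by `hV`, which gives `yK`.
  obtain ⟨y, hy⟩ : ∃ y : ℕ → ℕ → ℂ, y = fun i j => if m ≤ i ∧ m ≤ j then x i j else
      if d ≤ i ∧ i < e ∧ d ≤ j ∧ j < e then x (s + e - 1 - i) (s + e - 1 - j) else 0 := ⟨_, rfl⟩
  have yR : ∀ i j, m ≤ i → m ≤ j → y i j = x i j := by
    intro i j h1 h2
    rw [hy]
    exact if_pos ⟨h1, h2⟩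
  have y0 : ∀ i j, (i < m ∨ j < m) → (i < d ∨ e ≤ i ∨ j < d ∨ e ≤ j) → y i j = 0 := by
    intro i j h1 h2
    simp only [hy]
    rw [if_neg (by omega), if_neg (by omega)]
  have yK : ∀ i j, d ≤ i → i < e → d ≤ j → j < e →
      y i j = x (s + e - 1 - i) (s + e - 1 - j) := by
    intro i j h1 h2 h3 h4
    by_cases hc : m ≤ i ∧ m ≤ j
    · rw [yR i j hc.1 hc.2, hV i j (s + e - 1 - i) (s + e - 1 - j) h1 h2 hc.2 h4 (by omega)
        (by omega), if_pos (by omega)]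
    · simp only [hy]
      rw [if_neg hc, if_pos ⟨h1, h2, h3, h4⟩]
  obtain ⟨h1, h2⟩ := h y S
    (by
      intro i j hij
      by_cases hc : m ≤ i ∧ m ≤ j
      · rw [yR i j hc.1 hc.2]
        apply hx
        intro hal
        apply hij
        rcases hal with ⟨h1, h2⟩ | ⟨h1, h2⟩
        · refine Or.inl ⟨h1, ?_⟩
          rcases h2 with h2 | h2
          · exact Or.inl ⟨by omega, by omega, by omega, by omega⟩
          · exact Or.inr h2
        · refine Or.inr ⟨h1, ?_⟩
          rcases h2 with h2 | h2
          · omega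
          · exact Or.inr h2
      · by_cases hc' : d ≤ i ∧ i < e ∧ d ≤ j ∧ j < e
        · obtain ⟨a1, a2, a3, a4⟩ := hc'
          rw [yK i j a1 a2 a3 a4]
          have hlt : i < j := by
            by_contra hle
            exact hij (Or.inl ⟨by omega, Or.inl ⟨a1, a2, a3, a4⟩⟩)
          have hjm : m ≤ j := by
            by_contra hle
            exact hij (Or.inr ⟨by omega, Or.inl ⟨by omega, by omega, by omega, by omega⟩⟩)
          exact hZ _ _ (by omega) (by omega) (by omega)
        · exact y0 i j (by omega) (by omega))
    (by
      intro i j a b c d'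
      rw [yR i j (by omega) (by omega), yR j i (by omega) (by omega), hT i j a b c d']) hS
    (by
      intro i j hij
      have hd : d ≤ i ∧ d ≤ j := by
        rcases hij with ⟨h1, h2 | h2⟩ | ⟨h1, h2 | h2⟩
        · omega
        · have := hR _ _ h2
          omega
        · omega
        · have := hQ _ _ h2
          omega
      obtain ⟨hdi, hdj⟩ := hd
      have hold : m ≤ i → Allowed (consBlock s e R) (consBlock s m Q) i j := by
        intro hmi
        rcases hij with ⟨h1, h2 | h2⟩ | ⟨h1, h2 | h2⟩
        · exact hlow _ _ h1 (by omega) (by omega)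
        · exact Or.inl ⟨h1, Or.inr h2⟩
        · omega
        · exact Or.inr ⟨h1, Or.inr h2⟩
      by_cases hi : i < e
      · by_cases hj : j < e
        · have e1 := hI j i (s + e - 1 - j) (s + e - 1 - i) hdj hj hdi hi (by omega) (by omega)
          have f1 := yK (d + e - 1 - j) i (by omega) (by omega) hdi hi
          have f2 := yK j (d + e - 1 - i) hdj hj (by omega) (by omega)
          rw [arcBracket, consMirror_of_mem (p := d + e - 1 - j) σ hdj hj (by omega),
            consMirror_of_mem (p := d + e - 1 - i) σ hdi hi (by omega), f1, f2]
          by_cases hjm : j < m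
          · rw [if_neg (by omega : ¬ (t ≤ i ∧ _)),
              consMirror_of_mem (p := s + e - 1 - j) τ hdj hjm (by omega),
              yK (s + e - 1 - j) i (by omega) (by omega) hdi hi,
              show s + e - 1 - (s + e - 1 - j) = j by omega]
            by_cases him : i < m
            · rw [consMirror_of_mem (p := s + e - 1 - i) τ hdi him (by omega),
                yK j (s + e - 1 - i) hdj hj (by omega) (by omega),
                show s + e - 1 - (s + e - 1 - i) = i by omega]
              linear_combination e1
            · have z : y j (τ i) = 0 := by
                have hti := hτ i (by omega)
                by_cases hte : τ i < e
                · rw [yK j (τ i) hdj hj (by omega) hte]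
                  exact hZ _ _ (by omega) (by omega) (by omega)
                · exact y0 _ _ (by omega) (by omega)
              rw [consMirror_of_le τ (by omega : m ≤ i), z, ite_self]
              rw [if_neg (by omega : ¬ i < s + e - 1 - i)] at e1
              linear_combination e1
          · have him : m ≤ i := by
              rcases hij with ⟨h1, h2⟩ | ⟨h1, h2 | h2⟩
              · omega
              · omega
              · exact (hQ _ _ h2).1
            have e2 := hE i j (hold him)
            rw [← e2, consMirror_of_le τ him, consMirror_of_le τ (by omega : m ≤ j),
              yR _ _ (hτ j (by omega)) him, yR _ _ (by omega) (hτ i him), arcBracket,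
              consMirror_of_mem (p := s + e - 1 - j) σ (by omega) hj (by omega),
              consMirror_of_mem (p := s + e - 1 - i) σ (by omega) hi (by omega),
              consMirror_of_le τ him, consMirror_of_le τ (by omega : m ≤ j),
              if_neg (by omega : ¬ j < s + e - 1 - j), if_pos (by omega : s + e - 1 - i < i)]
            rw [if_pos (by omega : s + e - 1 - j < j), if_neg (by omega : ¬ i < s + e - 1 - i)]
              at e1
            linear_combination e1
        · have him : m ≤ i := by
            rcases hij with ⟨h1, h2⟩ | ⟨h1, h2 | h2⟩
            · omega
            · omega
            · exact (hQ _ _ h2).1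
          have hej : e ≤ j := by omega
          have z : y j (d + e - 1 - i) = 0 := by
            by_cases hc : m ≤ d + e - 1 - i
            · rw [yR _ _ (by omega) hc]
              exact low0 _ _ hej (by omega)
            · exact y0 _ _ (by omega) (by omega)
          have hσj := hσ j hej
          rw [← hE i j (hold him), arcBracket, arcBracket,
            consMirror_of_mem (p := d + e - 1 - i) σ hdi hi (by omega),
            consMirror_of_mem (s := s) (p := s + e - 1 - i) σ (by omega) hi (by omega),
            consMirror_of_le σ hej, consMirror_of_le σ hej, consMirror_of_le τ him,
            consMirror_of_le τ (by omega : m ≤ j), consMirror_of_le τ him,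
            consMirror_of_le τ (by omega : m ≤ j), z, low0 j (s + e - 1 - i) hej (by omega),
            yR _ _ (by omega) him, yR _ _ (hτ j (by omega)) him, yR _ _ (by omega) (hτ i him)]
          simp only [ite_self]
      · have hei : e ≤ i := by omega
        have hej : e ≤ j := by
          rcases hij with ⟨h1, h2 | h2⟩ | ⟨h1, h2⟩
          · omega
          · exact (hR _ _ h2).2
          · omega
        have hσj := hσ j hej
        have hσi := hσ i hei
        rw [← hE i j (hold (by omega)), arcBracket, arcBracket,
          consMirror_of_le σ hei, consMirror_of_le σ hei, consMirror_of_le σ hej,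
          consMirror_of_le σ hej, consMirror_of_le τ (by omega : m ≤ i),
          consMirror_of_le τ (by omega : m ≤ j), consMirror_of_le τ (by omega : m ≤ i),
          consMirror_of_le τ (by omega : m ≤ j), yR _ _ (by omega) (by omega),
          yR _ _ (hτ j (by omega)) (by omega), yR _ _ (by omega) (hτ i (by omega)),
          yR _ _ (by omega) (by omega)])
  refine ⟨?_, h2⟩
  have hII : ∀ i j, i < m → x i j = 0 := by
    intro i j hi
    by_cases hj : m ≤ j
    · exact row0 i j hi hj
    by_cases hs : i < s ∨ j < s
    · exact neg0 i j hs
    have := yK (s + e - 1 - i) (s + e - 1 - j) (by omega) (by omega) (by omega) (by omega)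
    rw [h1, show s + e - 1 - (s + e - 1 - i) = i by omega,
      show s + e - 1 - (s + e - 1 - j) = j by omega] at this
    exact this.symm
  intro i j
  by_cases hi : i < m
  · exact hII i j hi
  by_cases hj : m ≤ j
  · rw [← yR i j (by omega) hj, h1]
  by_cases hs : j < s
  · exact neg0 i j (Or.inr hs)
  by_cases hie : e ≤ i
  · exact low0 i j hie (by omega)
  -- Rows [m,e) and columns [s,m) remain. This test isolates x i j, as every other term lies in a
  -- row below m; S does not appear because j < m ≤ t.
  have := hE j (s + e - 1 - i) (hup _ _ (by omega) (by omega) (by omega) (by omega))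
  rw [arcBracket, consMirror_of_mem (i := s + e - 1 - i) (p := i) σ (by omega) (by omega)
      (by omega), if_pos (by omega : s + e - 1 - i < i),
    consMirror_of_mem (i := s + e - 1 - i) (p := s + m - 1 - (s + e - 1 - i)) τ (by omega)
      (by omega) (by omega), hII (s + m - 1 - (s + e - 1 - i)) j (by omega),
    hII (s + e - 1 - i) (consMirror s e σ j) (by omega),
    hII (s + e - 1 - i) (consMirror s m τ j) (by omega),
    if_neg (by omega : ¬ (_ ∧ _))] at this
  simpa using this

/-! ### Consecutive blocks and their reversals -/

/-- The positions `i` and `j` lie in one block, where the blocks of sizes `l` start at `s` and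
are completed by a last block reaching up to `N`. -/
def blockRel (N : ℕ) : List ℕ → ℕ → ℕ → ℕ → Prop
  | [], s => fun i j => s ≤ i ∧ i < N ∧ s ≤ j ∧ j < N
  | x :: l, s => consBlock s (s + x) (blockRel N l (s + x))

/-- Reversal of every one of the consecutive blocks of sizes `l` starting at `s`. -/
def blockMirror : List ℕ → ℕ → ℕ → ℕ
  | [], _ => id
  | x :: l, s => consMirror s (s + x) (blockMirror l (s + x))

theorem blockRel.le {N : ℕ} {l : List ℕ} {s i j : ℕ} (h : blockRel N l s i j) :
    s ≤ i ∧ s ≤ j := by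
  induction l generalizing s with
  | nil => exact ⟨h.1, h.2.2.1⟩
  | cons x l ih =>
    rcases h with h | h
    · exact ⟨h.1, h.2.2.1⟩
    · have := ih h
      omega

theorem blockRel.lt {N : ℕ} {l : List ℕ} {s i j : ℕ} (hN : s + l.sum ≤ N)
    (h : blockRel N l s i j) : i < N ∧ j < N := by
  induction l generalizing s with
  | nil => exact ⟨h.2.1, h.2.2.2⟩
  | cons x l ih =>
    rw [List.sum_cons] at hN
    rcases h with h | h
    · omega
    · exact ih (by omega) h

theorem blockRel.symm {N : ℕ} {l : List ℕ} {s i j : ℕ} (h : blockRel N l s i j) :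
    blockRel N l s j i := by
  induction l generalizing s with
  | nil => exact ⟨h.2.2.1, h.2.2.2, h.1, h.2.1⟩
  | cons x l ih =>
    rcases h with h | h
    · exact Or.inl ⟨h.2.2.1, h.2.2.2, h.1, h.2.1⟩
    · exact Or.inr (ih h)

theorem le_blockMirror {l : List ℕ} {s i : ℕ} (h : s ≤ i) : s ≤ blockMirror l s i := by
  induction l generalizing s with
  | nil => exact h
  | cons x l ih =>
    rw [blockMirror, consMirror]
    split_ifs with hc
    · omega
    · have := @ih (s + x) (by omega)
      omega

theorem blockMirror_of_lt {l : List ℕ} {s i : ℕ} (h : i < s) : blockMirror l s i = i := by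
  induction l generalizing s with
  | nil => rfl
  | cons x l ih =>
    rw [blockMirror, consMirror, if_neg (by omega)]
    exact ih (by omega)

theorem blockMirror_of_sum_le {l : List ℕ} {s i : ℕ} (h : s + l.sum ≤ i) :
    blockMirror l s i = i := by
  induction l generalizing s with
  | nil => rfl
  | cons x l ih =>
    rw [List.sum_cons] at h
    rw [blockMirror, consMirror, if_neg (by omega)]
    exact ih (by omega)

theorem blockMirror_lt {l : List ℕ} {s i : ℕ} (h : i < s + l.sum) :
    blockMirror l s i < s + l.sum := by
  induction l generalizing s with
  | nil => exact h
  | cons x l ih =>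
    rw [List.sum_cons] at h ⊢
    rw [blockMirror, consMirror]
    split_ifs
    · omega
    · have := @ih (s + x) (by omega)
      omega

theorem blockMirror_blockMirror (l : List ℕ) (s i : ℕ) :
    blockMirror l s (blockMirror l s i) = i := by
  induction l generalizing s with
  | nil => rfl
  | cons x l ih =>
    simp only [blockMirror]
    by_cases h1 : s ≤ i ∧ i < s + x
    · rw [consMirror_of_mem (i := i) (p := s + (s + x) - 1 - i) _ h1.1 h1.2 (by omega),
        consMirror_of_mem (p := i) _ (by omega) (by omega) (by omega)]
    · rw [consMirror, if_neg]
      · rw [consMirror, if_neg h1]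
        exact ih _
      · rw [consMirror, if_neg h1]
        by_cases h2 : i < s + x
        · rw [blockMirror_of_lt h2]
          exact h1
        · have := @le_blockMirror l (s + x) i (by omega)
          omega

theorem blockRel_congr {M N : ℕ} {l : List ℕ} {s i j : ℕ} (hi : i < N ↔ i < M)
    (hj : j < N ↔ j < M) : blockRel N l s i j ↔ blockRel M l s i j := by
  induction l generalizing s with
  | nil => simp only [blockRel, hi, hj]
  | cons x l ih => simp only [blockRel, consBlock, ih]

theorem blockRel_of_sum_le {N : ℕ} {l : List ℕ} {s i j : ℕ} (h : s + l.sum ≤ i) :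
    blockRel N l s i j ↔ i < N ∧ s + l.sum ≤ j ∧ j < N := by
  induction l generalizing s with
  | nil =>
    simp only [List.sum_nil] at h
    simp only [blockRel, List.sum_nil]
    omega
  | cons x l ih =>
    rw [List.sum_cons] at h ⊢
    rw [blockRel, consBlock, ih (by omega)]
    omega

theorem consBlock_self (s : ℕ) (R : ℕ → ℕ → Prop) : consBlock s s R = R := by
  funext i j
  simp only [consBlock, eq_iff_iff]
  constructor
  · rintro (h | h)
    · omega
    · exact h
  · exact Or.inr

theorem consMirror_self (s : ℕ) (σ : ℕ → ℕ) : consMirror s s σ = σ := by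
  funext i
  rw [consMirror, if_neg (by omega)]

theorem blockRel_replicate_one {N q s i j : ℕ} (hN : N = s + q)
    (h : blockRel N (List.replicate q 1) s i j) : i = j := by
  induction q generalizing s with
  | zero => exact absurd h (by rw [List.replicate_zero, blockRel]; omega)
  | succ q ih =>
    rw [List.replicate_succ, blockRel] at h
    rcases h with h | h
    · omega
    · exact ih (by omega) h

/-! ### Induction along the winding-down -/

/-- If no component is deleted, the tail is `1 | ⋯ | 1` (`q` entries) and the aftertail is `2`,
then one of the compositions has sum `n - 1` and the other one has sum `n - 1 - q`. -/
theorem HomotopyTypeC.sums {n : ℕ} {a b D c : List ℕ} {r q : ℕ} (h : HomotopyTypeC n a b D c r)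
    (hD : D = []) (hc : c = List.replicate q 1) (hr : r = 2) (ha : a.sum ≤ n) (hb : b.sum ≤ n) :
    (a.sum + 1 = n ∧ b.sum + q + 1 = n) ∨ (b.sum + 1 = n ∧ a.sum + q + 1 = n) := by
  induction h with
  | doneBot n c => subst hc; simp at *; omega
  | doneTop n c => subst hc; simp at *; omega
  | pureContraction h _ ih =>
    have := ih hD hc hr
    simp only [List.sum_cons] at *
    omega
  | blockElimination h _ ih =>
    have := ih hD hc hr
    simp only [List.sum_cons] at *
    omega
  | rotationContraction h h' _ ih =>
    have := ih hD hc hr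
    simp only [List.sum_cons] at *
    omega
  | componentDeletion => simp at hD
  | flip h _ ih =>
    have := ih hD hc hr
    simp only [List.sum_cons] at *
    omega

/-- Here t = s, so x is skew everywhere on [s,N). The blocks of size 1 allow only diagonal entries,
the empty list all upper triangular ones; an upper triangular skew matrix is zero. The bracket then
vanishes, which kills S on and above the diagonal, and by symmetry everywhere. -/
theorem rigid_replicate_one {N q s : ℕ} (hN : N = s + q) :
    Rigid (blockRel N (List.replicate q 1) s) (blockRel N [] s)
      (blockMirror (List.replicate q 1) s) (blockMirror [] s) s N := by
  intro x S hx hT hS hE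
  have hx0 : ∀ i j, x i j = 0 := by
    intro i j
    by_cases hij : s ≤ i ∧ i < N ∧ s ≤ j ∧ j < N
    · have anti := hT i j hij.1 hij.2.1 hij.2.2.1 hij.2.2.2
      have low : ∀ i j, j < i → x i j = 0 := by
        intro i j h
        apply hx
        rintro (⟨h1, h2⟩ | ⟨h1, h2⟩)
        · have := blockRel_replicate_one hN h2
          omega
        · omega
      rcases lt_trichotomy i j with h | h | h
      · rw [anti, low j i h, neg_zero]
      · subst h
        exact self_eq_neg.1 anti
      · exact low i j h
    · apply hx
      rintro (⟨h1, h2⟩ | ⟨h1, h2⟩)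
      · have h3 := blockRel_replicate_one hN h2
        have h4 := h2.le
        have h5 := h2.lt (by simp [hN])
        omega
      · exact hij h2
  refine ⟨hx0, ?_⟩
  have up : ∀ i j, s ≤ i → i < N → s ≤ j → j < N → i ≤ j → S j i = 0 := by
    intro i j a b c d h
    have := hE i j (Or.inr ⟨h, a, b, c, d⟩)
    rw [if_pos ⟨a, b, c, d⟩] at this
    rw [← this]
    simp [arcBracket, hx0]
  intro i j a b c d
  rcases le_total i j with h | h
  · rw [hS i j a b c d, up i j a b c d h]
  · exact up j i c d a b h

/-- The meander left after each move occupies the positions [s,N): its left end `s` grows by the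
number of vertices lost, while N and the tail [N-q,N) stay fixed. -/
theorem HomotopyTypeC.rigid {n : ℕ} {a b D c : List ℕ} {r q N : ℕ}
    (h : HomotopyTypeC n a b D c r) (hD : D = []) (hc : c = List.replicate q 1) (hr : r = 2)
    (ha : a.sum ≤ n) (hb : b.sum ≤ n) (s : ℕ) (hN : N + 1 = s + n) :
    Rigid (blockRel N a s) (blockRel N b s) (blockMirror a s) (blockMirror b s) (N - q) N := by
  have hsums := h.sums hD hc hr ha hb
  induction h generalizing s with
  | doneBot n c =>
    subst hc
    simp only [List.sum_replicate, smul_eq_mul, mul_one] at hr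
    have : N - q = s := by omega
    rw [this]
    exact rigid_replicate_one (by omega)
  | doneTop n c =>
    subst hc
    simp only [List.sum_replicate, smul_eq_mul, mul_one] at hr
    have : N - q = s := by omega
    rw [this]
    exact (rigid_replicate_one (by omega)).flip (fun _ _ => blockRel.symm)
      (fun _ _ => blockRel.symm)
  | @pureContraction n x y a b D c r h h' ih =>
    simp only [List.sum_cons] at ha hb hsums ih
    have := ih hD hc hr (by omega) (by omega) (s + y) (by omega) (by omega)
    have e : s + y + (x - 2 * y) + y = s + x := by omega
    simp only [blockRel, blockMirror, e] at this ⊢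
    exact Rigid.contraction (by omega) (by omega) (by omega) (by omega) (by omega)
      (fun _ _ => blockRel.le) (fun _ _ => blockRel.le) (fun _ => le_blockMirror)
      (fun _ => le_blockMirror) this
  | @blockElimination n x y a b D c r h h' ih =>
    simp only [List.sum_cons] at ha hb hsums ih
    have := ih hD hc hr (by omega) (by omega) (s + y) (by omega) (by omega)
    have e : s + y + y = s + x := by omega
    simp only [blockRel, blockMirror, e] at this ⊢
    -- Block elimination is the contraction with k = m, whose extra top block [m,k) is empty.
    rw [← consBlock_self (s + y) (consBlock _ _ _), ← consMirror_self (s + y) (consMirror _ _ _)]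
      at this
    exact Rigid.contraction (by omega) (by omega) (by omega) (by omega) (by omega)
      (fun _ _ => blockRel.le) (fun _ _ => blockRel.le) (fun _ => le_blockMirror)
      (fun _ => le_blockMirror) this
  | @rotationContraction n x y a b D c r h h' _ ih =>
    simp only [List.sum_cons] at ha hb hsums ih
    have := ih hD hc hr (by omega) (by omega) (s + (x - y)) (by omega) (by omega)
    have e : s + (x - y) + y = s + x := by omega
    have e' : s + (x - y) + (2 * y - x) = s + y := by omega
    simp only [blockRel, blockMirror, e, e'] at this ⊢
    exact Rigid.rotation (by omega) (by omega) (by omega) (by omega) (by omega)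
      (fun _ _ => blockRel.le) (fun _ _ => blockRel.le) (fun _ => le_blockMirror)
      (fun _ => le_blockMirror) this
  | componentDeletion => simp at hD
  | flip h _ ih =>
    exact (ih hD hc hr hb ha s hN hsums.symm).flip (fun _ _ => blockRel.symm)
      (fun _ _ => blockRel.symm)

/-! ### From the full composition to recursive blocks -/

theorem inBlock_zero_cons {x : ℕ} {l : List ℕ} {i : ℕ} : InBlock (x :: l) 0 i ↔ i < x := by
  simp [InBlock]

theorem inBlock_succ_cons {x : ℕ} {l : List ℕ} {k i : ℕ} :
    InBlock (x :: l) (k + 1) i ↔ x ≤ i ∧ InBlock l k (i - x) := by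
  simp only [InBlock, List.take_succ_cons, List.sum_cons]
  omega

theorem sameBlock_cons {x : ℕ} {l : List ℕ} {i j : ℕ} :
    SameBlock (x :: l) i j ↔ (i < x ∧ j < x) ∨ (x ≤ i ∧ x ≤ j ∧ SameBlock l (i - x) (j - x)) := by
  constructor
  · rintro ⟨_ | k, h1, h2⟩
    · exact Or.inl ⟨inBlock_zero_cons.1 h1, inBlock_zero_cons.1 h2⟩
    · rw [inBlock_succ_cons] at h1 h2
      exact Or.inr ⟨h1.1, h2.1, k, h1.2, h2.2⟩
  · rintro (⟨h1, h2⟩ | ⟨h1, h2, k, h3, h4⟩)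
    · exact ⟨0, inBlock_zero_cons.2 h1, inBlock_zero_cons.2 h2⟩
    · exact ⟨k + 1, inBlock_succ_cons.2 ⟨h1, h3⟩, inBlock_succ_cons.2 ⟨h2, h4⟩⟩

theorem isArc_cons {x : ℕ} {l : List ℕ} {i j : ℕ} :
    IsArc (x :: l) i j ↔ (i ≠ j ∧ i < x ∧ j < x ∧ i + j + 1 = x) ∨
      (x ≤ i ∧ x ≤ j ∧ IsArc l (i - x) (j - x)) := by
  constructor
  · rintro ⟨h0, _ | k, h1, h2, h3⟩
    · refine Or.inl ⟨h0, inBlock_zero_cons.1 h1, inBlock_zero_cons.1 h2, ?_⟩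
      simpa using h3
    · rw [inBlock_succ_cons] at h1 h2
      simp only [List.take_succ_cons, List.sum_cons] at h3
      exact Or.inr ⟨h1.1, h2.1, by omega, k, h1.2, h2.2, by omega⟩
  · rintro (⟨h0, h1, h2, h3⟩ | ⟨h1, h2, h0, k, h3, h4, h5⟩)
    · exact ⟨h0, 0, inBlock_zero_cons.2 h1, inBlock_zero_cons.2 h2, by simpa using h3⟩
    · refine ⟨by omega, k + 1, inBlock_succ_cons.2 ⟨h1, h3⟩, inBlock_succ_cons.2 ⟨h2, h4⟩, ?_⟩
      simp only [List.take_succ_cons, List.sum_cons]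
      omega

/-- For positions in the blocks of `a` or in the middle block of size `M`, the blocks listed after
`M` play no role, so the middle block can serve as the completing last block of `blockRel`. -/
theorem sameBlock_append {a c : List ℕ} {M s i j : ℕ} (hi : s ≤ i) (hi' : i < s + a.sum + M)
    (hj : s ≤ j) :
    SameBlock (a ++ M :: c) (i - s) (j - s) ↔ blockRel (s + a.sum + M) a s i j := by
  induction a generalizing s with
  | nil =>
    simp only [List.sum_nil] at hi'
    simp only [List.nil_append, sameBlock_cons, blockRel, List.sum_nil]
    omega
  | cons x a ih =>
    rw [List.sum_cons] at hi' ⊢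
    rw [List.cons_append, sameBlock_cons, blockRel, consBlock]
    by_cases h : s + x ≤ i ∧ s + x ≤ j
    · have := @ih (s + x) h.1 (by omega) h.2
      rw [show i - s - x = i - (s + x) by omega, show j - s - x = j - (s + x) by omega, this,
        show s + x + a.sum = s + (x + a.sum) by omega]
      constructor
      · rintro (h' | ⟨-, -, h'⟩)
        · omega
        · exact Or.inr h'
      · rintro (h' | h')
        · omega
        · exact Or.inr ⟨by omega, by omega, h'⟩
    · constructor
      · rintro (h' | h') <;> left <;> omega
      · rintro (h' | h')
        · left
          omega
        · exact absurd h'.le h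

theorem isArc_append {a c : List ℕ} {M s i j : ℕ} (hi : s ≤ i) (hi' : i < s + a.sum + M)
    (hj : s ≤ j) :
    IsArc (a ++ M :: c) (i - s) (j - s) ↔ i ≠ j ∧ ((i < s + a.sum ∧ j = blockMirror a s i) ∨
      (s + a.sum ≤ i ∧ i + j + 1 = 2 * (s + a.sum) + M)) := by
  induction a generalizing s with
  | nil =>
    simp only [List.sum_nil] at hi'
    simp only [List.nil_append, isArc_cons, List.sum_nil]
    omega
  | cons x a ih =>
    rw [List.sum_cons] at hi' ⊢
    rw [List.cons_append, isArc_cons, blockMirror]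
    by_cases h : s + x ≤ i
    · rw [consMirror_of_le _ h]
      by_cases h' : s + x ≤ j
      · have := @ih (s + x) h (by omega) h'
        rw [show i - s - x = i - (s + x) by omega, show j - s - x = j - (s + x) by omega, this]
        have e : s + x + a.sum = s + (x + a.sum) := by omega
        rw [e]
        constructor
        · rintro (h' | ⟨-, -, h'⟩)
          · omega
          · exact h'
        · exact fun h' => Or.inr ⟨by omega, by omega, h'⟩
      · have := @le_blockMirror a (s + x) i h
        omega
    · rw [consMirror_of_mem (p := s + (s + x) - 1 - i) _ hi (by omega) (by omega)]
      omega

theorem sum_fullComposition {n : ℕ} {a : List ℕ} (ha : a.sum ≤ n) :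
    (fullComposition n a).sum = 2 * n := by
  simp only [fullComposition, List.sum_append, List.sum_cons, List.sum_reverse]
  omega

theorem sameBlock_fullComposition {n : ℕ} {a : List ℕ} {i j : ℕ} (ha : a.sum ≤ n)
    (hi : i < 2 * n - a.sum) :
    SameBlock (fullComposition n a) i j ↔ blockRel (2 * n - a.sum) a 0 i j := by
  have := @sameBlock_append a a.reverse (2 * (n - a.sum)) 0 i j (by omega) (by omega) (by omega)
  rw [show 0 + a.sum + 2 * (n - a.sum) = 2 * n - a.sum by omega] at this
  exact this

theorem isArc_fullComposition {n : ℕ} {a : List ℕ} {i j : ℕ} (ha : a.sum ≤ n)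
    (hi : i < 2 * n - a.sum) :
    IsArc (fullComposition n a) i j ↔ i ≠ j ∧ ((i < a.sum ∧ j = blockMirror a 0 i) ∨
      (a.sum ≤ i ∧ i + j + 1 = 2 * n)) := by
  have := @isArc_append a a.reverse (2 * (n - a.sum)) 0 i j (by omega) (by omega) (by omega)
  rw [show 2 * (0 + a.sum) + 2 * (n - a.sum) = 2 * n by omega, Nat.zero_add] at this
  exact this

theorem IsArc.symm {l : List ℕ} {i j : ℕ} (h : IsArc l i j) : IsArc l j i := by
  obtain ⟨h0, k, h1, h2, h3⟩ := h
  exact ⟨h0.symm, k, h2, h1, by omega⟩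

theorem reverse_fullComposition (n : ℕ) (a : List ℕ) :
    (fullComposition n a).reverse = fullComposition n a := by
  simp [fullComposition]

theorem InBlock.reverse {l : List ℕ} {k i : ℕ} (h : InBlock l k i) :
    InBlock l.reverse (l.length - 1 - k) (l.sum - 1 - i) := by
  have hk : k < l.length := by
    by_contra hk
    -- Past the end of the list both prefix sums equal the total, which leaves no position for `i`.
    have h1 := h.1
    have h2 := h.2
    rw [List.take_of_length_le (by omega)] at h1 h2
    omega
  have key : ∀ m, m ≤ l.length → (l.reverse.take (l.length - m)).sum + (l.take m).sum = l.sum := by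
    intro m hm
    rw [List.take_reverse, List.sum_reverse, show l.length - (l.length - m) = m by omega, add_comm,
      List.sum_take_add_sum_drop]
  have k1 := key k (by omega)
  have k2 := key (k + 1) (by omega)
  have h1 := h.1
  have h2 := h.2
  rw [InBlock, show l.length - 1 - k + 1 = l.length - k by omega,
    show l.length - 1 - k = l.length - (k + 1) by omega]
  omega

theorem SameBlock.rev {n : ℕ} {a : List ℕ} (ha : a.sum ≤ n) {i j : ℕ}
    (h : SameBlock (fullComposition n a) i j) :
    SameBlock (fullComposition n a) (2 * n - 1 - i) (2 * n - 1 - j) := by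
  obtain ⟨k, h1, h2⟩ := h
  have h1 := h1.reverse
  have h2 := h2.reverse
  rw [reverse_fullComposition, sum_fullComposition ha] at h1 h2
  exact ⟨_, h1, h2⟩

/-- The full compositions are palindromes, so the reflection in the antidiagonal preserves the
admissible locations. -/
theorem Admissible.rev {n : ℕ} {a b : List ℕ} (ha : a.sum ≤ n) (hb : b.sum ≤ n) {i j : ℕ}
    (h : Admissible n a b i j) : Admissible n a b (2 * n - 1 - j) (2 * n - 1 - i) := by
  rcases h with ⟨h1, h2⟩ | ⟨h1, h2⟩
  · exact Or.inl ⟨by omega, (h2.rev ha).symm⟩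
  · exact Or.inr ⟨by omega, (h2.rev hb).symm⟩

/-! ### Symplectic symmetry and the form on matrix units -/

/-- The sign `ε i`. -/
noncomputable def halfSign (n i : ℕ) : ℂ := if i < n then 1 else -1

theorem halfSign_mul_self (n i : ℕ) : halfSign n i * halfSign n i = 1 := by
  unfold halfSign
  split_ifs <;> simp

theorem halfSign_rev {n : ℕ} (i : Fin (2 * n)) : halfSign n i.rev = - halfSign n i := by
  have := i.2
  simp only [halfSign, Fin.val_rev]
  split_ifs <;> first | omega | simp

/-- Compare the entries of xᵀJ = -Jx; the signs square to 1 and change under reversal. -/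
theorem mem_sp_iff {n : ℕ} {x : Matrix (Fin (2 * n)) (Fin (2 * n)) ℂ} :
    x ∈ sp n ↔ ∀ i j : Fin (2 * n), x j.rev i.rev = -(halfSign n i * halfSign n j) * x i j := by
  have hJ : ∀ i j : Fin (2 * n), antidiagonalJ n i j = if i = j.rev then halfSign n i else 0 := by
    intro i j
    have : (i : ℕ) + j + 1 = 2 * n ↔ i = j.rev := by
      rw [Fin.ext_iff, Fin.val_rev]
      omega
    simp only [antidiagonalJ, Matrix.of_apply, this, halfSign]
  have hJ' : ∀ i j : Fin (2 * n), antidiagonalJ n i j = if j = i.rev then halfSign n i else 0 := by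
    intro i j
    rw [hJ]
    have : i = j.rev ↔ j = i.rev := by
      constructor <;> rintro rfl <;> simp
    simp only [this]
  have h1 : x ∈ sp n ↔ x.transpose * antidiagonalJ n = antidiagonalJ n * (-x) := by
    rw [sp, mem_skewAdjointMatricesLieSubalgebra, mem_skewAdjointMatricesSubmodule]
    rfl
  rw [h1, ← Matrix.ext_iff]
  have h2 : ∀ i j, (x.transpose * antidiagonalJ n) i j = x j.rev i * halfSign n j.rev := by
    intro i j
    simp [Matrix.mul_apply, hJ]
  have h3 : ∀ i j, (antidiagonalJ n * (-x)) i j = - (halfSign n i * x i.rev j) := by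
    intro i j
    simp [Matrix.mul_apply, hJ']
  simp only [h2, h3]
  constructor
  · intro h i j
    have := h i.rev j
    rw [halfSign_rev, halfSign_rev, Fin.rev_rev] at this
    linear_combination (-halfSign n j) * this - x j.rev i.rev * halfSign_mul_self n j
  · intro h i j
    have := h i.rev j
    rw [halfSign_rev, Fin.rev_rev] at this
    rw [halfSign_rev, this]
    linear_combination (-halfSign n i * x i.rev j) * halfSign_mul_self n j

/-- A square matrix as a function on pairs of natural numbers. -/
noncomputable def extend {m : ℕ} (x : Matrix (Fin m) (Fin m) ℂ) (i j : ℕ) : ℂ :=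
  if h : i < m ∧ j < m then x ⟨i, h.1⟩ ⟨j, h.2⟩ else 0

theorem extend_coe {m : ℕ} (x : Matrix (Fin m) (Fin m) ℂ) (i j : Fin m) :
    extend x i j = x i j := by
  simp [extend]

/-- The extension of `aftertailForm` to all matrices. -/
noncomputable def matrixForm {n : ℕ} (hn : 0 < n) (a b : List ℕ) :
    Matrix (Fin (2 * n)) (Fin (2 * n)) ℂ →ₗ[ℂ] ℂ :=
  Matrix.entryLinearMap ℂ ℂ (idxN hn) (idxN hn) +
    ∑ p ∈ formEdges n a b, Matrix.entryLinearMap ℂ ℂ p.1 p.2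

theorem matrixForm_apply {n : ℕ} (hn : 0 < n) (a b : List ℕ)
    (x : Matrix (Fin (2 * n)) (Fin (2 * n)) ℂ) :
    matrixForm hn a b x = x (idxN hn) (idxN hn) + ∑ p ∈ formEdges n a b, x p.1 p.2 := by
  simp [matrixForm]

theorem aftertailForm_apply {n : ℕ} (hn : 0 < n) (a b : List ℕ) (y : seaweed n a b) :
    aftertailForm hn a b y = matrixForm hn a b y := by
  rw [matrixForm_apply, aftertailForm, LinearMap.add_apply, LinearMap.sum_apply]
  rfl

theorem sum_ite_val_eq {m : ℕ} (P : Prop) [Decidable P] (k : ℕ) (hk : P → k < m) (f : ℕ → ℂ) :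
    (∑ i : Fin m, if P ∧ (i : ℕ) = k then f i else 0) = if P then f k else 0 := by
  by_cases hP : P
  · simp only [hP, true_and, if_true]
    rw [Finset.sum_eq_single ⟨k, hk hP⟩]
    · simp
    · intro i _ hi
      rw [if_neg]
      exact fun h => hi (Fin.ext h)
    · simp
  · simp [hP]

theorem sum_eq_sum_column {m : ℕ} (E : Finset (Fin m × Fin m)) (M : Matrix (Fin m) (Fin m) ℂ)
    (v : Fin m) (f : Fin m → ℂ) (h : ∀ i j, M i j = if v = j then f i else 0) :
    ∑ p ∈ E, M p.1 p.2 = ∑ i, if (i, v) ∈ E then f i else 0 := by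
  have : ∑ p ∈ E, M p.1 p.2 = ∑ p, if p ∈ E then M p.1 p.2 else 0 := by simp
  rw [this, Fintype.sum_prod_type]
  refine Finset.sum_congr rfl fun i _ => ?_
  rw [Finset.sum_eq_single v]
  · rw [h, if_pos rfl]
  · intro j _ hj
    rw [h, if_neg hj.symm, ite_self]
  · simp

theorem mem_formEdges_iff {n : ℕ} {a b : List ℕ} {p : Fin (2 * n) × Fin (2 * n)} :
    p ∈ formEdges n a b ↔ OrientedFullMeanderEdge n a b p.1 p.2 ∧
      ((p.1 : ℕ) + 1 ≤ n - 1 ∨ (p.2 : ℕ) + 1 ≤ n - 1) := by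
  classical
  exact Finset.mem_filter.trans (and_iff_right (Finset.mem_univ _))

section Edges

variable {n N t : ℕ} {a b : List ℕ}

/-- The restriction on the labels discards the right-hand copies of the arcs and the arcs joining N
to N+1. What survives are the arcs of the blocks of `a` and of `b`, and the arcs of the middle
b-block that start in [t,N). -/
theorem mem_formEdges (hN : N + 1 = n) (ha : a.sum = N) (hb : b.sum = t) (ht : t ≤ N)
    (i j : Fin (2 * n)) :
    (i, j) ∈ formEdges n a b ↔ ((j : ℕ) < i ∧ (i : ℕ) = blockMirror a 0 j) ∨
      ((i : ℕ) < j ∧ (j : ℕ) = blockMirror b 0 i) ∨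
      (t ≤ (i : ℕ) ∧ (i : ℕ) < N ∧ (i : ℕ) + j + 1 = 2 * n) := by
  have hi := i.2
  have hj := j.2
  rw [mem_formEdges_iff, OrientedFullMeanderEdge]
  dsimp only
  have arcA : (j : ℕ) < N → (IsArc (fullComposition n a) i j ↔
      (i : ℕ) ≠ j ∧ (i : ℕ) = blockMirror a 0 j) := by
    intro h
    have := @isArc_fullComposition n a j i (by omega) (by omega)
    rw [show IsArc (fullComposition n a) i j ↔ IsArc (fullComposition n a) j i from
      ⟨IsArc.symm, IsArc.symm⟩, this]
    omega
  have arcB : (i : ℕ) < N → (IsArc (fullComposition n b) i j ↔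
      (i : ℕ) ≠ j ∧ (((i : ℕ) < t ∧ (j : ℕ) = blockMirror b 0 i) ∨
        (t ≤ (i : ℕ) ∧ (i : ℕ) + j + 1 = 2 * n))) := by
    intro h
    rw [isArc_fullComposition (by omega) (by omega), hb]
  have geA : N ≤ (j : ℕ) → blockMirror a 0 j = j := fun h => blockMirror_of_sum_le (by omega)
  have geB : t ≤ (i : ℕ) → blockMirror b 0 i = i := fun h => blockMirror_of_sum_le (by omega)
  constructor
  · rintro ⟨⟨h1, h2⟩ | ⟨h1, h2⟩, h3⟩
    · rw [arcA (by omega)] at h2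
      exact Or.inl ⟨h1, h2.2⟩
    · rw [arcB (by omega)] at h2
      omega
  · rintro (⟨h1, h2⟩ | ⟨h1, h2⟩ | ⟨h1, h2, h3⟩)
    · have : (j : ℕ) < N := by
        by_contra h
        rw [geA (by omega)] at h2
        omega
      exact ⟨Or.inl ⟨h1, (arcA this).2 ⟨by omega, h2⟩⟩, by omega⟩
    · have : (i : ℕ) < t := by
        by_contra h
        rw [geB (by omega)] at h2
        omega
      exact ⟨Or.inr ⟨h1, (arcB (by omega)).2 ⟨by omega, Or.inl ⟨this, h2⟩⟩⟩, by omega⟩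
    · exact ⟨Or.inr ⟨by omega, (arcB h2).2 ⟨by omega, Or.inr ⟨h1, h3⟩⟩⟩, by omega⟩

theorem eq_blockMirror_iff {l : List ℕ} {s i j : ℕ} :
    j = blockMirror l s i ↔ i = blockMirror l s j := by
  constructor <;> rintro rfl <;> rw [blockMirror_blockMirror]

theorem matrixForm_mul_single (hn : 0 < n) (hN : N + 1 = n) (ha : a.sum = N) (hb : b.sum = t)
    (ht : t ≤ N) (x : Matrix (Fin (2 * n)) (Fin (2 * n)) ℂ) (u v : Fin (2 * n)) :
    matrixForm hn a b (x * Matrix.single u v 1) =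
      (if (v : ℕ) = N then extend x N u else 0) +
      (if (v : ℕ) < blockMirror a 0 v then extend x (blockMirror a 0 v) u else 0) +
      (if blockMirror b 0 v < (v : ℕ) then extend x (blockMirror b 0 v) u else 0) +
      (if t ≤ 2 * n - 1 - (v : ℕ) ∧ 2 * n - 1 - (v : ℕ) < N then
        extend x (2 * n - 1 - (v : ℕ)) u else 0) := by
  have hu := u.2
  have hv := v.2
  have hmul : ∀ i j, (x * Matrix.single u v (1 : ℂ)) i j = if v = j then x i u else 0 := by
    intro i j
    simp [Matrix.mul_apply, Matrix.single_apply, ite_and]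
  rw [matrixForm_apply]
  have h0 : (x * Matrix.single u v (1 : ℂ)) (idxN hn) (idxN hn) =
      if (v : ℕ) = N then extend x N u else 0 := by
    have e : ((idxN hn : Fin (2 * n)) : ℕ) = N := by simp [idxN]; omega
    rw [hmul, ← extend_coe x, e]
    exact if_congr (by rw [Fin.ext_iff, e]) rfl rfl
  have h1 : ∑ p ∈ formEdges n a b, (x * Matrix.single u v (1 : ℂ)) p.1 p.2 =
      ∑ i, if (i, v) ∈ formEdges n a b then extend x i u else 0 := by
    exact sum_eq_sum_column _ _ v _ fun i j => by rw [hmul, extend_coe]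
  rw [h0, h1]
  simp only [add_assoc]
  congr 1
  -- Only edges ending at `v` matter; each of the three families contains at most one, and the
  -- families are disjoint.
  have A := sum_ite_val_eq (m := 2 * n) ((v : ℕ) < blockMirror a 0 v) (blockMirror a 0 v)
    (fun h => by
      by_cases hc : (v : ℕ) < 0 + a.sum
      · have := blockMirror_lt hc
        omega
      · rw [blockMirror_of_sum_le (by omega)]
        omega) (fun i => extend x i u)
  have B := sum_ite_val_eq (m := 2 * n) (blockMirror b 0 v < (v : ℕ)) (blockMirror b 0 v)
    (fun h => by omega) (fun i => extend x i u)
  have C := sum_ite_val_eq (m := 2 * n) (t ≤ 2 * n - 1 - (v : ℕ) ∧ 2 * n - 1 - (v : ℕ) < N)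
    (2 * n - 1 - (v : ℕ)) (fun h => by omega) (fun i => extend x i u)
  rw [← A, ← B, ← C, ← Finset.sum_add_distrib, ← Finset.sum_add_distrib]
  refine Finset.sum_congr rfl fun i _ => ?_
  have hi := i.2
  have key := mem_formEdges hN ha hb ht i v
  rw [eq_blockMirror_iff (i := i)] at key
  have c1 : (v : ℕ) < i ∧ (i : ℕ) = blockMirror a 0 v ↔
      (v : ℕ) < blockMirror a 0 v ∧ (i : ℕ) = blockMirror a 0 v := by omega
  have c2 : (i : ℕ) < v ∧ (i : ℕ) = blockMirror b 0 v ↔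
      blockMirror b 0 v < (v : ℕ) ∧ (i : ℕ) = blockMirror b 0 v := by omega
  have c3 : (t ≤ (i : ℕ) ∧ (i : ℕ) < N ∧ (i : ℕ) + v + 1 = 2 * n) ↔
      (t ≤ 2 * n - 1 - (v : ℕ) ∧ 2 * n - 1 - (v : ℕ) < N) ∧ (i : ℕ) = 2 * n - 1 - (v : ℕ) := by
    omega
  have geB : (t ≤ (v : ℕ) → blockMirror b 0 v = v) := fun h => blockMirror_of_sum_le (by omega)
  rw [c1, c2, c3] at key
  by_cases k1 : (v : ℕ) < blockMirror a 0 v ∧ (i : ℕ) = blockMirror a 0 v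
  · rw [if_pos (key.2 (Or.inl k1)), if_pos k1, if_neg (by omega), if_neg]
    · simp
    · intro k3
      have : blockMirror a 0 v = v := blockMirror_of_sum_le (by omega)
      omega
  · by_cases k2 : blockMirror b 0 v < (v : ℕ) ∧ (i : ℕ) = blockMirror b 0 v
    · rw [if_pos (key.2 (Or.inr (Or.inl k2))), if_neg k1, if_pos k2, if_neg (by omega)]
      simp
    · simp only [k1, k2, false_or] at key
      simp only [k1, k2, key, if_false, zero_add]

theorem matrixForm_single_mul (hn : 0 < n) (hN : N + 1 = n) (ha : a.sum = N) (hb : b.sum = t)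
    (ht : t ≤ N) (x : Matrix (Fin (2 * n)) (Fin (2 * n)) ℂ) (u v : Fin (2 * n)) :
    matrixForm hn a b (Matrix.single u v 1 * x) =
      (if (u : ℕ) = N then extend x v N else 0) +
      (if blockMirror a 0 u < (u : ℕ) then extend x v (blockMirror a 0 u) else 0) +
      (if (u : ℕ) < blockMirror b 0 u then extend x v (blockMirror b 0 u) else 0) +
      (if t ≤ (u : ℕ) ∧ (u : ℕ) < N then extend x v (2 * n - 1 - (u : ℕ)) else 0) := by
  have hu := u.2
  have hv := v.2
  have hmul : ∀ i j, (Matrix.single u v (1 : ℂ) * x) i j = if u = i then x v j else 0 := by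
    intro i j
    simp [Matrix.mul_apply, Matrix.single_apply, ite_and]
  rw [matrixForm_apply]
  have h0 : (Matrix.single u v (1 : ℂ) * x) (idxN hn) (idxN hn) =
      if (u : ℕ) = N then extend x v N else 0 := by
    have e : ((idxN hn : Fin (2 * n)) : ℕ) = N := by simp [idxN]; omega
    rw [hmul, ← extend_coe x, e]
    exact if_congr (by rw [Fin.ext_iff, e]) rfl rfl
  have h1 : ∑ p ∈ formEdges n a b, (Matrix.single u v (1 : ℂ) * x) p.1 p.2 =
      ∑ j, if (u, j) ∈ formEdges n a b then extend x v j else 0 := by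
    have := sum_eq_sum_column ((formEdges n a b).map (Equiv.prodComm _ _).toEmbedding)
      (Matrix.single u v (1 : ℂ) * x).transpose u (fun j => extend x v j)
      fun j i => by rw [Matrix.transpose_apply, hmul, extend_coe]
    rw [Finset.sum_map] at this
    simpa using this
  rw [h0, h1]
  simp only [add_assoc]
  congr 1
  have A := sum_ite_val_eq (m := 2 * n) (blockMirror a 0 u < (u : ℕ)) (blockMirror a 0 u)
    (fun h => by omega) (fun i => extend x v i)
  have B := sum_ite_val_eq (m := 2 * n) ((u : ℕ) < blockMirror b 0 u) (blockMirror b 0 u)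
    (fun h => by
      by_cases hc : (u : ℕ) < 0 + b.sum
      · have := blockMirror_lt hc
        omega
      · rw [blockMirror_of_sum_le (by omega)]
        omega) (fun i => extend x v i)
  have C := sum_ite_val_eq (m := 2 * n) (t ≤ (u : ℕ) ∧ (u : ℕ) < N)
    (2 * n - 1 - (u : ℕ)) (fun h => by omega) (fun i => extend x v i)
  rw [← A, ← B, ← C, ← Finset.sum_add_distrib, ← Finset.sum_add_distrib]
  refine Finset.sum_congr rfl fun j _ => ?_
  have hj := j.2
  have key := mem_formEdges hN ha hb ht u j
  rw [eq_blockMirror_iff (i := j)] at key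
  have c1 : (j : ℕ) < u ∧ (j : ℕ) = blockMirror a 0 u ↔
      blockMirror a 0 u < (u : ℕ) ∧ (j : ℕ) = blockMirror a 0 u := by omega
  have c2 : (u : ℕ) < j ∧ (j : ℕ) = blockMirror b 0 u ↔
      (u : ℕ) < blockMirror b 0 u ∧ (j : ℕ) = blockMirror b 0 u := by omega
  have c3 : (t ≤ (u : ℕ) ∧ (u : ℕ) < N ∧ (u : ℕ) + j + 1 = 2 * n) ↔
      (t ≤ (u : ℕ) ∧ (u : ℕ) < N) ∧ (j : ℕ) = 2 * n - 1 - (u : ℕ) := by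
    omega
  have geB : (t ≤ (u : ℕ) → blockMirror b 0 u = u) := fun h => blockMirror_of_sum_le (by omega)
  rw [c1, c2, c3] at key
  by_cases k1 : blockMirror a 0 u < (u : ℕ) ∧ (j : ℕ) = blockMirror a 0 u
  · rw [if_pos (key.2 (Or.inl k1)), if_pos k1, if_neg (by omega), if_neg (by omega)]
    simp
  · by_cases k2 : (u : ℕ) < blockMirror b 0 u ∧ (j : ℕ) = blockMirror b 0 u
    · rw [if_pos (key.2 (Or.inr (Or.inl k2))), if_neg k1, if_pos k2, if_neg (by omega)]
      simp
    · simp only [k1, k2, false_or] at key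
      simp only [k1, k2, key, if_false, zero_add]

end Edges

/-! ### The kernel equations in the symplectic seaweed -/

theorem mem_seaweed_iff {n : ℕ} {a b : List ℕ} {x : Matrix (Fin (2 * n)) (Fin (2 * n)) ℂ} :
    x ∈ seaweed n a b ↔
      (∀ i j : Fin (2 * n), x j.rev i.rev = -(halfSign n i * halfSign n j) * x i j) ∧
      ∀ i j : Fin (2 * n), ¬ Admissible n a b i j → x i j = 0 := by
  rw [seaweed, LieSubalgebra.mem_inf, mem_sp_iff]
  rfl

theorem single_sub_single_mem {n : ℕ} {a b : List ℕ} (ha : a.sum ≤ n) (hb : b.sum ≤ n)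
    {u v : Fin (2 * n)} (h : Admissible n a b u v) :
    Matrix.single u v (1 : ℂ) - (halfSign n u * halfSign n v) • Matrix.single v.rev u.rev (1 : ℂ) ∈
      seaweed n a b := by
  rw [mem_seaweed_iff]
  constructor
  · intro i j
    simp only [Matrix.sub_apply, Matrix.smul_apply, Matrix.single_apply, Fin.rev_inj, smul_eq_mul]
    have e1 : (u = j.rev ∧ v = i.rev) ↔ (v.rev = i ∧ u.rev = j) := by
      constructor <;> rintro ⟨rfl, rfl⟩ <;> simp
    rw [if_congr e1 rfl rfl, if_congr (and_comm : v = j ∧ u = i ↔ u = i ∧ v = j) rfl rfl]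
    have h1 : (halfSign n i * halfSign n j) * (if u = i ∧ v = j then (1 : ℂ) else 0) =
        (halfSign n u * halfSign n v) * (if u = i ∧ v = j then (1 : ℂ) else 0) := by
      split_ifs with hc
      · rw [hc.1, hc.2]
      · simp
    have h2 : (halfSign n i * halfSign n j) * (if v.rev = i ∧ u.rev = j then (1 : ℂ) else 0) =
        (halfSign n u * halfSign n v) * (if v.rev = i ∧ u.rev = j then (1 : ℂ) else 0) := by
      split_ifs with hc
      · rw [← hc.1, ← hc.2, halfSign_rev, halfSign_rev]
        ring
      · simp
    have h3 := halfSign_mul_self n u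
    have h4 := halfSign_mul_self n v
    set p := if u = i ∧ v = j then (1 : ℂ) else 0
    set q := if v.rev = i ∧ u.rev = j then (1 : ℂ) else 0
    linear_combination h1 - (halfSign n u * halfSign n v) * h2 -
      q * (halfSign n v * halfSign n v) * h3 - q * h4
  · intro i j hij
    have h' := h.rev ha hb
    have e1 : ¬ (u = i ∧ v = j) := by
      rintro ⟨rfl, rfl⟩
      exact hij h
    have e2 : ¬ (v.rev = i ∧ u.rev = j) := by
      rintro ⟨rfl, rfl⟩
      apply hij
      convert h' using 1 <;> rw [Fin.val_rev] <;> omega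
    simp [e1, e2]

/-- The `(v, u)` entry of `[f, X]`, where `f` represents the form `aftertailForm` in the case that
the blocks of `a` and `b` cover the first `N = n - 1` and `t` positions. -/
noncomputable def fullBracket (N t : ℕ) (σ τ : ℕ → ℕ) (X : ℕ → ℕ → ℂ) (u v : ℕ) : ℂ :=
  arcBracket σ τ X v u + (if v = N then X N u else 0) - (if u = N then X v N else 0) +
    (if t ≤ 2 * N + 1 - v ∧ 2 * N + 1 - v < N then X (2 * N + 1 - v) u else 0) -
    (if t ≤ u ∧ u < N then X v (2 * N + 1 - u) else 0)

section Kernel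

variable {n N t : ℕ} {a b : List ℕ}

/-- Test x against e_{u,v} minus its signed reflection, which lies in the seaweed. Since
`matrixForm` is defined on all matrices, the two units can be evaluated separately. -/
theorem fullBracket_eq (hn : 0 < n) (hN : N + 1 = n) (ha : a.sum = N) (hb : b.sum = t)
    (ht : t ≤ N) {x : Matrix (Fin (2 * n)) (Fin (2 * n)) ℂ}
    (hx : ∀ y ∈ seaweed n a b, matrixForm hn a b ⁅x, y⁆ = 0) {u v : Fin (2 * n)}
    (h : Admissible n a b u v) :
    fullBracket N t (blockMirror a 0) (blockMirror b 0) (extend x) u v =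
      halfSign n u * halfSign n v *
        fullBracket N t (blockMirror a 0) (blockMirror b 0) (extend x) (2 * N + 1 - v)
          (2 * N + 1 - u) := by
  have key : ∀ u v : Fin (2 * n), matrixForm hn a b ⁅x, Matrix.single u v (1 : ℂ)⁆ =
      fullBracket N t (blockMirror a 0) (blockMirror b 0) (extend x) u v := by
    intro u v
    rw [Ring.lie_def, map_sub, matrixForm_mul_single hn hN ha hb ht,
      matrixForm_single_mul hn hN ha hb ht, fullBracket, arcBracket,
      show 2 * n - 1 = 2 * N + 1 by omega]
    ring
  have := hx _ (single_sub_single_mem (by omega) (by omega) h)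
  rw [lie_sub, lie_smul, map_sub, map_smul, key, key, Fin.val_rev, Fin.val_rev, smul_eq_mul,
    show 2 * n - ((v : ℕ) + 1) = 2 * N + 1 - v by omega,
    show 2 * n - ((u : ℕ) + 1) = 2 * N + 1 - u by omega] at this
  exact sub_eq_zero.1 this

theorem admissible_iff_allowed (hN : N + 1 = n) (ha : a.sum = N) (hb : b.sum = t)
    (ht : t ≤ N) {i j : ℕ} (hi : i < N) (hj : j < N) :
    Admissible n a b i j ↔ Allowed (blockRel N a 0) (blockRel N b 0) i j := by
  rw [Admissible, Allowed, sameBlock_fullComposition (by omega) (by omega),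
    sameBlock_fullComposition (by omega) (by omega),
    blockRel_congr (M := N) (N := 2 * n - a.sum) (by omega) (by omega),
    blockRel_congr (M := N) (N := 2 * n - b.sum) (by omega) (by omega)]

theorem admissible_of_le (hN : N + 1 = n) (hb : b.sum = t) (ht : t ≤ N) {i j : ℕ}
    (hi : t ≤ i) (hij : i ≤ j) (hj : j < 2 * n - t) : Admissible n a b i j := by
  refine Or.inr ⟨hij, ?_⟩
  rw [sameBlock_fullComposition (by omega) (by omega), blockRel_of_sum_le (by omega)]
  omega

theorem not_admissible_of_lt (hN : N + 1 = n) (hb : b.sum = t) (ht : t ≤ N)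
    {i j : ℕ} (hi : i < t) (hj : N ≤ j) : ¬ Admissible n a b i j := by
  rintro (⟨h1, h2⟩ | ⟨h1, h2⟩)
  · omega
  · rw [sameBlock_fullComposition (by omega) (by omega)] at h2
    have := (blockRel_of_sum_le (by omega)).1 h2.symm
    omega

theorem not_admissible_of_far (hN : N + 1 = n) (hb : b.sum = t) (ht : t ≤ N)
    {i j : ℕ} (hi : i ≤ N) (hj : 2 * n - t ≤ j) : ¬ Admissible n a b i j := by
  rintro (⟨h1, h2⟩ | ⟨h1, h2⟩)
  · omega
  · rw [sameBlock_fullComposition (by omega) (by omega)] at h2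
    have := h2.lt (by omega)
    omega

theorem not_admissible_of_gt (hN : N + 1 = n) (ha : a.sum = N)
    {i j : ℕ} (hi : N ≤ i) (hj : j < N) : ¬ Admissible n a b i j := by
  rintro (⟨h1, h2⟩ | ⟨h1, h2⟩)
  · have h3 := (sameBlock_fullComposition (by omega) (by omega)).1 h2.symm
    have := (blockRel_of_sum_le (by omega)).1 h3.symm
    omega
  · omega

/-- The corner and the middle pair are tested first; this supplies the skewness needed for `hrigid`.
Rigidity then kills the upper left part and the corner, and the symplectic symmetry transfers the
vanishing to the remaining entries. -/
theorem eq_zero_of_fullBracket (hN : N + 1 = n) (ha : a.sum = N) (hb : b.sum = t)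
    (ht : t ≤ N)
    (hrigid : Rigid (blockRel N a 0) (blockRel N b 0) (blockMirror a 0) (blockMirror b 0) t N)
    {X : ℕ → ℕ → ℂ} (hX : ∀ i j, ¬ (i < 2 * n ∧ j < 2 * n ∧ Admissible n a b i j) → X i j = 0)
    (hsp : ∀ i j, i < 2 * n → j < 2 * n →
      X (2 * N + 1 - j) (2 * N + 1 - i) = -(halfSign n i * halfSign n j) * X i j)
    (hK : ∀ u v, u < 2 * n → v < 2 * n → Admissible n a b u v →
      fullBracket N t (blockMirror a 0) (blockMirror b 0) X u v = halfSign n u * halfSign n v *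
        fullBracket N t (blockMirror a 0) (blockMirror b 0) X (2 * N + 1 - v) (2 * N + 1 - u))
    {i j : ℕ} (hNN : ¬ (i = N ∧ j = N)) (hnn : ¬ (i = n ∧ j = n)) : X i j = 0 := by
  have up0 : ∀ i j, i < t → N ≤ j → X i j = 0 := fun i j h1 h2 =>
    hX _ _ fun h => not_admissible_of_lt hN hb ht h1 h2 h.2.2
  have far0 : ∀ i j, i ≤ N → 2 * n - t ≤ j → X i j = 0 := fun i j h1 h2 =>
    hX _ _ fun h => not_admissible_of_far hN hb ht h1 h2 h.2.2
  have low0 : ∀ i j, N ≤ i → j < N → X i j = 0 := fun i j h1 h2 =>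
    hX _ _ fun h => not_admissible_of_gt hN ha h1 h2 h.2.2
  have spdiff : ∀ i j, i < n → n ≤ j → j < 2 * n →
      X (2 * N + 1 - j) (2 * N + 1 - i) = X i j := by
    intro i j h1 h2 h3
    rw [hsp i j (by omega) h3, halfSign, halfSign, if_pos h1, if_neg (by omega)]
    ring
  have spsame : ∀ i j, i < n → j < n →
      X (2 * N + 1 - j) (2 * N + 1 - i) = - X i j := by
    intro i j h1 h2
    rw [hsp i j (by omega) (by omega), halfSign, halfSign, if_pos h1, if_pos h2]
    ring
  have σN : ∀ w, N ≤ w → blockMirror a 0 w = w := fun w h => blockMirror_of_sum_le (by omega)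
  have τt : ∀ w, t ≤ w → blockMirror b 0 w = w := fun w h => blockMirror_of_sum_le (by omega)
  have σlt : ∀ w, w < N → blockMirror a 0 w < N := by
    intro w h
    have := @blockMirror_lt a 0 w (by omega)
    omega
  have τlt : ∀ w, w < N → blockMirror b 0 w < N := by
    intro w h
    by_cases hw : w < t
    · have := @blockMirror_lt b 0 w (by omega)
      omega
    · rw [τt w (by omega)]
      exact h
  -- Both mirrors fix `v`, and the bottom one fixes `u`. The only term that can survive has column <
  -- N and row ≥ N, where X vanishes.
  have br0 : ∀ v u, N ≤ v → t ≤ u →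
      arcBracket (blockMirror a 0) (blockMirror b 0) X v u = 0 := by
    intro v u h1 h2
    rw [arcBracket, σN v h1, τt v (by omega), τt u h2]
    simp only [lt_irrefl, if_false, add_zero, zero_sub, sub_zero, neg_eq_zero, ite_eq_right_iff]
    intro h
    apply low0 _ _ h1
    by_contra hc
    have : u = blockMirror a 0 (blockMirror a 0 u) := (blockMirror_blockMirror a 0 u).symm
    rw [σN (blockMirror a 0 u) (by omega)] at this
    omega
  -- test against the entries in the upper right corner
  have skew : ∀ i j, t ≤ i → i < N → t ≤ j → j < N → X i j = - X j i := by
    intro i j h1 h2 h3 h4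
    have := hK i (2 * N + 1 - j) (by omega) (by omega)
      (admissible_of_le hN hb ht h1 (by omega) (by omega))
    rw [fullBracket, fullBracket, br0 _ _ (by omega) h1, br0 _ _ (by omega) (by omega), halfSign,
      halfSign, if_pos (by omega : i < n), if_neg (by omega : ¬ 2 * N + 1 - j < n),
      if_neg (by omega), if_neg (by omega), if_pos (by omega), if_pos (by omega),
      if_neg (by omega), if_neg (by omega), if_pos (by omega), if_pos (by omega),
      show 2 * N + 1 - (2 * N + 1 - j) = j by omega,
      show 2 * N + 1 - (2 * N + 1 - i) = i by omega,
      spsame i j (by omega) (by omega), spsame j i (by omega) (by omega)] at this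
    linear_combination this / 2
  have eN : 2 * N + 1 - (N + 1) = N := by omega
  have eN' : 2 * N + 1 - N = N + 1 := by omega
  -- Here an arc of the middle b-block and e_{n,n}^* interact; the symplectic symmetry makes the
  -- resulting equation a multiple of one entry.
  have colN' : ∀ i, t ≤ i → i < N → X i N = 0 := by
    intro i h1 h2
    have := hK i (N + 1) (by omega) (by omega)
      (admissible_of_le hN hb ht h1 (by omega) (by omega))
    have e1 := spsame i N (by omega) (by omega)
    have e2 := hsp (N + 1) i (by omega) (by omega)
    rw [low0 (N + 1) i (by omega) h2, mul_zero, eN] at e2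
    rw [eN'] at e1
    rw [eN] at this
    simp (disch := omega) only [fullBracket, br0, if_pos, if_neg, if_true, halfSign, eN,
      show 2 * N + 1 - (2 * N + 1 - i) = i by omega, e1, e2] at this
    linear_combination this / 2
  have colN : ∀ i, t ≤ i → i < N → X i (N + 1) = 0 := by
    intro i h1 h2
    have := hK i N (by omega) (by omega)
      (admissible_of_le hN hb ht h1 (by omega) (by omega))
    have e1 := spdiff i (N + 1) (by omega) (by omega) (by omega)
    rw [eN] at e1
    rw [eN'] at this
    simp (disch := omega) only [fullBracket, br0, if_pos, if_neg, if_true, halfSign, eN', low0,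
      show 2 * N + 1 - (2 * N + 1 - i) = i by omega, e1] at this
    linear_combination -this / 2
  -- The sl₂ on N, N+1: only e_{n,n}^* contributes, and the off-diagonal units force the opposite
  -- entries to vanish.
  have cornerLow : X (N + 1) N = 0 := by
    have := hK N (N + 1) (by omega) (by omega)
      (admissible_of_le hN hb ht (by omega) (by omega) (by omega))
    rw [eN, eN'] at this
    simp (disch := omega) only [fullBracket, br0, if_pos, if_neg, if_true, halfSign, eN, eN'] at this
    linear_combination -this / 2
  have cornerUp : X N (N + 1) = 0 := by
    have := hK (N + 1) N (by omega) (by omega) (by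
      refine Or.inl ⟨by omega, ?_⟩
      rw [sameBlock_fullComposition (by omega) (by omega), blockRel_of_sum_le (by omega)]
      omega)
    rw [eN, eN'] at this
    simp (disch := omega) only [fullBracket, br0, if_pos, if_neg, if_true, halfSign, eN, eN'] at this
    linear_combination this / 2
  -- S collects the corner entries contributed by the arcs of the middle b-block to the test unit
  -- and to its reflection. By the symplectic symmetry it is twice the corner, so its vanishing
  -- kills the corner in `row0`.
  obtain ⟨left0, hS⟩ := hrigid (fun i j => if i < N ∧ j < N then X i j else 0)
    (fun j i => X j (2 * N + 1 - i) + X i (2 * N + 1 - j))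
    (by
      intro i j hij
      by_cases hc : i < N ∧ j < N
      · rw [if_pos hc]
        apply hX
        rintro ⟨-, -, h⟩
        exact hij ((admissible_iff_allowed hN ha hb ht hc.1 hc.2).1 h)
      · rw [if_neg hc])
    (by
      intro i j h1 h2 h3 h4
      rw [if_pos ⟨h2, h4⟩, if_pos ⟨h4, h2⟩]
      exact skew i j h1 h2 h3 h4)
    (fun i j _ _ _ _ => add_comm _ _)
    (by
      intro u v huv
      have hlt : u < N ∧ v < N := by
        rcases huv with ⟨-, h⟩ | ⟨-, h⟩
        · exact h.lt (by omega)
        · exact h.lt (by omega)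
      obtain ⟨hu, hv⟩ := hlt
      have := hK u v (by omega) (by omega) ((admissible_iff_allowed hN ha hb ht hu hv).2 huv)
      have e : arcBracket (blockMirror a 0) (blockMirror b 0)
          (fun i j => if i < N ∧ j < N then X i j else 0) v u =
          arcBracket (blockMirror a 0) (blockMirror b 0) X v u := by
        simp only [arcBracket, hu, hv, σlt u hu, σlt v hv, τlt u hu, τlt v hv, and_self, if_true]
      rw [fullBracket, fullBracket, br0 (2 * N + 1 - u) (2 * N + 1 - v) (by omega) (by omega),
        halfSign, halfSign, if_pos (by omega : u < n), if_pos (by omega : v < n), if_neg (by omega),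
        if_neg (by omega), if_neg (by omega), if_neg (by omega : ¬ (2 * N + 1 - u = N)),
        if_neg (by omega : ¬ (2 * N + 1 - v = N)),
        if_neg (by omega : ¬ (t ≤ 2 * N + 1 - v ∧ 2 * N + 1 - v < N)),
        show 2 * N + 1 - (2 * N + 1 - u) = u by omega] at this
      rw [e]
      by_cases hc : t ≤ u ∧ u < N
      · rw [if_pos hc, if_pos hc] at this
        by_cases hc' : t ≤ v
        · rw [if_pos ⟨hc.1, hc.2, hc', hv⟩]
          linear_combination this
        · rw [up0 v _ (by omega) (by omega), far0 u _ (by omega) (by omega)] at this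
          rw [if_neg (by omega)]
          linear_combination this
      · rw [if_neg hc, if_neg hc] at this
        rw [if_neg (by omega)]
        linear_combination this)
  have row0 : ∀ i j, i < N → X i j = 0 := by
    intro i j hi
    by_cases hj : j < N
    · simpa [hi, hj] using left0 i j
    by_cases hit : i < t
    · exact up0 i j hit (by omega)
    by_cases hjt : 2 * n - t ≤ j
    · exact far0 i j (by omega) hjt
    rcases (by omega : j = N ∨ j = N + 1 ∨ N + 1 < j) with rfl | rfl | hj'
    · exact colN' i (by omega) hi
    · exact colN i (by omega) hi
    have h1 := hS i (2 * N + 1 - j) (by omega) hi (by omega) (by omega)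
    have h2 := spdiff i j (by omega) (by omega) (by omega)
    simp only [show 2 * N + 1 - (2 * N + 1 - j) = j by omega, h2] at h1
    linear_combination h1 / 2
  by_cases hr : i < 2 * n ∧ j < 2 * n
  swap
  · exact hX _ _ fun h => hr ⟨h.1, h.2.1⟩
  by_cases hi : i < N
  · exact row0 i j hi
  by_cases hj : j < N
  · exact low0 i j (by omega) hj
  have hs := hsp i j hr.1 hr.2
  have hne : -(halfSign n i * halfSign n j) ≠ 0 := by
    have := halfSign_mul_self n i
    have := halfSign_mul_self n j
    rw [neg_ne_zero]
    apply mul_ne_zero <;> rintro h <;> simp_all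
  have hs0 : X (2 * N + 1 - j) (2 * N + 1 - i) = 0 → X i j = 0 := fun h => by
    rw [h] at hs
    exact (mul_eq_zero.1 hs.symm).resolve_left hne
  by_cases hj' : N + 1 < j
  · exact hs0 (row0 _ _ (by omega))
  by_cases hi' : N + 1 < i
  · exact hs0 (low0 _ _ (by omega) (by omega))
  rcases (by omega : (i = N ∧ j = N + 1) ∨ (i = N + 1 ∧ j = N)) with ⟨rfl, rfl⟩ | ⟨rfl, rfl⟩
  · exact cornerUp
  · exact cornerLow

end Kernel

/-! ### The kernel and the reduction by transposition -/

/-- The matrix `e_{n,n} - e_{n+1,n+1}`. -/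
noncomputable abbrev middleCoroot {n : ℕ} (hn : 0 < n) : Matrix (Fin (2 * n)) (Fin (2 * n)) ℂ :=
  Matrix.single (idxN hn) (idxN hn) (1 : ℂ) - Matrix.single (idxNSucc hn) (idxNSucc hn) (1 : ℂ)

theorem rev_idxN {n : ℕ} (hn : 0 < n) : (idxN hn).rev = idxNSucc hn := by
  rw [Fin.ext_iff, Fin.val_rev]
  simp only [idxN, idxNSucc]
  omega

theorem middleCoroot_mem {n : ℕ} (hn : 0 < n) {a b : List ℕ} (ha : a.sum < n) (hb : b.sum < n) :
    middleCoroot hn ∈ seaweed n a b := by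
  have hadm : Admissible n a b (idxN hn : Fin (2 * n)) (idxN hn : Fin (2 * n)) := by
    refine Or.inl ⟨le_rfl, ?_⟩
    simp only [idxN]
    rw [sameBlock_fullComposition ha.le (by omega), blockRel_of_sum_le (by omega)]
    omega
  have := single_sub_single_mem ha.le hb.le hadm
  rwa [halfSign_mul_self, one_smul, rev_idxN] at this

theorem transpose_mem_seaweed {n : ℕ} {a b : List ℕ} {x : Matrix (Fin (2 * n)) (Fin (2 * n)) ℂ}
    (hx : x ∈ seaweed n a b) : x.transpose ∈ seaweed n b a := by
  rw [mem_seaweed_iff] at hx ⊢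
  refine ⟨fun i j => ?_, fun i j hij => hx.2 j i ?_⟩
  · rw [Matrix.transpose_apply, Matrix.transpose_apply, hx.1 j i, mul_comm (halfSign n j)]
  · rintro (⟨h1, h2⟩ | ⟨h1, h2⟩)
    · exact hij (Or.inr ⟨h1, h2.symm⟩)
    · exact hij (Or.inl ⟨h1, h2.symm⟩)

/-- Exchanging `a` and `b` reverses the orientation of every edge, and the diagonal term is
symmetric. -/
theorem matrixForm_transpose {n : ℕ} (hn : 0 < n) (a b : List ℕ)
    (x : Matrix (Fin (2 * n)) (Fin (2 * n)) ℂ) :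
    matrixForm hn b a x.transpose = matrixForm hn a b x := by
  rw [matrixForm_apply, matrixForm_apply, Matrix.transpose_apply]
  congr 1
  have swap : ∀ a b (p : Fin (2 * n) × Fin (2 * n)), p ∈ formEdges n a b →
      p.swap ∈ formEdges n b a := by
    intro a b p hp
    rw [mem_formEdges_iff] at hp ⊢
    refine ⟨?_, hp.2.symm⟩
    rcases hp.1 with ⟨h1, h2⟩ | ⟨h1, h2⟩
    · exact Or.inr ⟨h1, h2.symm⟩
    · exact Or.inl ⟨h1, h2.symm⟩
  exact Finset.sum_bij' (fun p _ => p.swap) (fun p _ => p.swap) (swap b a) (swap a b)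
    (fun _ _ => rfl) (fun _ _ => rfl) (fun _ _ => rfl)

theorem matrixForm_lie_eq_zero_iff_of_sum {n N t : ℕ} {a b : List ℕ} (hn : 0 < n) (hN : N + 1 = n)
    (ha : a.sum = N) (hb : b.sum = t) (ht : t ≤ N)
    (hrigid : Rigid (blockRel N a 0) (blockRel N b 0) (blockMirror a 0) (blockMirror b 0) t N)
    {x : Matrix (Fin (2 * n)) (Fin (2 * n)) ℂ} (hx : x ∈ seaweed n a b) :
    (∀ y ∈ seaweed n a b, matrixForm hn a b ⁅x, y⁆ = 0) ↔ ∃ c : ℂ, x = c • middleCoroot hn := by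
  have eN : ((idxN hn : Fin (2 * n)) : ℕ) = N := by
    simp only [idxN]
    omega
  have eN' : ((idxNSucc hn : Fin (2 * n)) : ℕ) = n := rfl
  rw [mem_seaweed_iff] at hx
  constructor
  · intro h
    have hz : ∀ i j : Fin (2 * n), ¬ ((i : ℕ) = N ∧ (j : ℕ) = N) → ¬ ((i : ℕ) = n ∧ (j : ℕ) = n) →
        x i j = 0 := by
      intro i j h1 h2
      rw [← extend_coe x]
      refine eq_zero_of_fullBracket hN ha hb ht hrigid ?_ ?_ ?_ h1 h2
      · intro i j hij
        unfold extend
        split_ifs with hc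
        · exact hx.2 _ _ fun h => hij ⟨hc.1, hc.2, h⟩
        · rfl
      · intro i j hi hj
        have := hx.1 ⟨i, hi⟩ ⟨j, hj⟩
        rw [← extend_coe x, ← extend_coe x, Fin.val_rev, Fin.val_rev] at this
        simp only at this
        rw [← this, show 2 * n - (j + 1) = 2 * N + 1 - j by omega,
          show 2 * n - (i + 1) = 2 * N + 1 - i by omega]
      · intro u v hu hv huv
        exact fullBracket_eq hn hN ha hb ht h (u := ⟨u, hu⟩) (v := ⟨v, hv⟩) huv
    refine ⟨x (idxN hn) (idxN hn), ?_⟩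
    ext i j
    simp only [Matrix.smul_apply, Matrix.sub_apply, Matrix.single_apply, smul_eq_mul]
    by_cases h1 : (i : ℕ) = N ∧ (j : ℕ) = N
    · obtain rfl : i = idxN hn := Fin.ext (h1.1.trans eN.symm)
      obtain rfl : j = idxN hn := Fin.ext (h1.2.trans eN.symm)
      have : ¬ idxNSucc hn = idxN hn := by
        rw [Fin.ext_iff, eN, eN']
        omega
      simp [this]
    · by_cases h2 : (i : ℕ) = n ∧ (j : ℕ) = n
      · obtain rfl : i = idxNSucc hn := Fin.ext h2.1
        obtain rfl : j = idxNSucc hn := Fin.ext h2.2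
        have : ¬ idxN hn = idxNSucc hn := by
          rw [Fin.ext_iff, eN, eN']
          omega
        have hs := hx.1 (idxN hn) (idxN hn)
        rw [rev_idxN, halfSign_mul_self] at hs
        simp [this, hs]
      · rw [hz i j h1 h2, if_neg, if_neg]
        · simp
        · rintro ⟨rfl, rfl⟩
          exact h2 ⟨rfl, rfl⟩
        · rintro ⟨rfl, rfl⟩
          exact h1 ⟨eN, eN⟩
  -- No arc of the form ends at N or N+1, so only the diagonal term remains, and its two
  -- contributions to the commutator cancel.
  · rintro ⟨c, rfl⟩ y -
    have σN : ∀ w, N ≤ w → blockMirror a 0 w = w := fun w h => blockMirror_of_sum_le (by omega)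
    have τN : ∀ w, N ≤ w → blockMirror b 0 w = w := fun w h => blockMirror_of_sum_le (by omega)
    rw [smul_lie, map_smul, sub_lie, map_sub, Ring.lie_def, Ring.lie_def, map_sub, map_sub]
    simp only [matrixForm_mul_single hn hN ha hb ht, matrixForm_single_mul hn hN ha hb ht, eN, eN']
    rw [σN N le_rfl, τN N le_rfl, σN n (by omega), τN n (by omega),
      if_neg (by omega : ¬ n = N), if_neg (by omega : ¬ n = N),
      if_neg (by omega : ¬ (t ≤ n ∧ n < N)), if_neg (by omega : ¬ (t ≤ N ∧ N < N)),
      if_neg (by omega : ¬ (t ≤ 2 * n - 1 - N ∧ _)), if_neg (by omega : ¬ (t ≤ 2 * n - 1 - n ∧ _))]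
    simp

theorem matrixForm_lie_eq_zero_iff {n q : ℕ} {a b : List ℕ} (hn : 0 < n) (ha : a.sum ≤ n)
    (hb : b.sum ≤ n) (hH : HomotopyTypeC n a b [] (List.replicate q 1) 2)
    {x : Matrix (Fin (2 * n)) (Fin (2 * n)) ℂ} (hx : x ∈ seaweed n a b) :
    (∀ y ∈ seaweed n a b, matrixForm hn a b ⁅x, y⁆ = 0) ↔ ∃ c : ℂ, x = c • middleCoroot hn := by
  have hrigid := hH.rigid (N := n - 1) rfl rfl rfl ha hb 0 (by omega)
  rcases hH.sums rfl rfl rfl ha hb with h | h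
  · exact matrixForm_lie_eq_zero_iff_of_sum hn (N := n - 1) (by omega) (by omega) (by omega)
      (by omega) hrigid hx
  · have key := matrixForm_lie_eq_zero_iff_of_sum hn (N := n - 1) (t := n - 1 - q) (by omega)
      (by omega) (by omega) (by omega)
      (hrigid.flip (fun _ _ => blockRel.symm) (fun _ _ => blockRel.symm))
      (transpose_mem_seaweed hx)
    -- Transposition is an anti-automorphism, hence the sign; it does not affect the kernel.
    have hform : ∀ y, matrixForm hn b a ⁅x.transpose, y.transpose⁆ = - matrixForm hn a b ⁅x, y⁆ := by
      intro y
      rw [← matrixForm_transpose, ← map_neg, Ring.lie_def, Ring.lie_def, Matrix.transpose_sub,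
        Matrix.transpose_mul, Matrix.transpose_mul, neg_sub]
      simp only [Matrix.transpose_transpose]
    have hcor : (middleCoroot hn).transpose = middleCoroot hn := by
      simp [middleCoroot, Matrix.transpose_single]
    constructor
    · intro hy
      obtain ⟨c, hc⟩ := key.1 fun y hym => by
        have := hform y.transpose
        rwa [Matrix.transpose_transpose, hy _ (transpose_mem_seaweed hym), neg_zero] at this
      refine ⟨c, ?_⟩
      rw [← Matrix.transpose_transpose x, hc, Matrix.transpose_smul, hcor]
    · rintro ⟨c, rfl⟩ y hym
      have := key.2 ⟨c, by rw [Matrix.transpose_smul, hcor]⟩ _ (transpose_mem_seaweed hym)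
      rw [hform, neg_eq_zero] at this
      exact this

end TypeCSeaweed

open TypeCSeaweed in
theorem theorem3p5 (n : ℕ) (hn : 0 < n) (a b : List ℕ)
    (ha : ∀ x ∈ a, 0 < x) (hb : ∀ x ∈ b, 0 < x) (hasum : a.sum ≤ n) (hbsum : b.sum ≤ n)
    (q : ℕ) (hH : HomotopyTypeC n a b [] (List.replicate q 1) 2) :
    ∃ hmem : Matrix.single (idxN hn) (idxN hn) (1 : ℂ) -
        Matrix.single (idxNSucc hn) (idxNSucc hn) (1 : ℂ) ∈ seaweed n a b,
      LinearMap.ker (kirillovForm (aftertailForm hn a b)) =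
        Submodule.span ℂ {(⟨_, hmem⟩ : seaweed n a b)} := by
  have hsums := hH.sums rfl rfl rfl hasum hbsum
  refine ⟨middleCoroot_mem hn (by omega) (by omega), ?_⟩
  ext ⟨x, hx⟩
  have key := matrixForm_lie_eq_zero_iff hn hasum hbsum hH hx
  rw [LinearMap.mem_ker, Submodule.mem_span_singleton]
  constructor
  · intro h
    obtain ⟨c, hc⟩ := key.1 fun y hy => by
      have := LinearMap.congr_fun h (⟨y, hy⟩ : seaweed n a b)
      exact (aftertailForm_apply hn a b _).symm.trans this
    exact ⟨c, Subtype.ext hc.symm⟩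
  · rintro ⟨c, hc⟩
    ext ⟨y, hy⟩
    have := key.2 ⟨c, (congrArg Subtype.val hc).symm⟩ y hy
    rw [LinearMap.zero_apply, ← this]
    exact aftertailForm_apply hn a b _
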